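/- Let $\mathbb K$ be $\mathbb R$ or $\mathbb C$. All spaces and algebras are over $\mathbb K$; algebras are associative but need not have a unit. Let $(G_i)_{i\ge 1}$ be a sequence of finite dimensional normed spaces such that (i) for every finite dimensional normed space $X$ and every $\varepsilon>0$ there is an $i$ with $d(X,G_i)<1+\varepsilon$, where $d(X,Y)=\inf\{\|T\|\,\|T^{-1}\| : T \text{ an isomorphism of } X \text{ onto } Y\}$; and (ii) for every $i$ there are infinitely many $j\ne i$ such that $G_j$ is isometric to $G_i$. For $1\le p\le\infty$ let $C_p=(\bigoplus_i G_i)_{\ell_p}$ be the $\ell_p$ direct sum, and let $C_0=(\bigoplus_i G_i)_{c_0}$ be the $c_0$ direct sum. For a Banach space $X$ let $\mathcal F(X)$ be the operator norm closure of the algebra of bounded finite rank operators on $X$. A left $A$-module $X$ is flat if $\,\cdot\otimes_A X$ turns every short exact sequence of right $A$-modules into a short exact sequence. An algebra $A$ is left flat if it is flat as a left $A$-module; it is left universally flat if, whenever $A$ is embedded as a left ideal in an algebra $B$, it is flat as a left $B$-module. A Banach space $X$ has the approximation property if for every compact $K\subset X$ and every $\varepsilon>0$ there is a bounded finite rank operator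 $T$ on $X$ with $\|Tx-x\|\le\varepsilon$ for all $x\in K$. Theorem. Let $E$ be a Banach space and let $C$ be one of the spaces $C_p$ with $1<p<\infty$, or $C_0$. The following are equivalent: (1) the dual space $E^*$ has the approximation property; (2) $\mathcal F(E\oplus C\oplus C[0,1])$ is left flat; (3) $\mathcal F(E\oplus C\oplus C[0,1])$ is left universally flat. Moreover, for every $1\le p\le\infty$ (endpoints included) and $C=C_p$, (2) and (3) are equivalent, and each of them implies (1). -/

import Mathlib

open scoped TensorProduct ENNReal Topology

universe u v w

/-! ### Modules over (not necessarily unital) algebras, balanced tensor products, flatness -/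

section Flatness

/-- A left module structure, over a not necessarily unital `𝕜`-algebra `A`, on the vector
space `X`. -/
structure AlgLeftModule (𝕜 : Type*) (A : Type*) (X : Type*) [Field 𝕜] [NonUnitalRing A]
    [Module 𝕜 A] [AddCommGroup X] [Module 𝕜 X] where
  /-- the action `(a, x) ↦ a x` -/
  act : A →ₗ[𝕜] X →ₗ[𝕜] X
  mul_act : ∀ (a b : A) (x : X), act (a * b) x = act a (act b x)

/-- A right module structure, over a not necessarily unital `𝕜`-algebra `A`, on the vector
space `M`. -/
structure AlgRightModule (𝕜 : Type*) (A : Type*) (M : Type*) [Field 𝕜] [NonUnitalRing A]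
    [Module 𝕜 A] [AddCommGroup M] [Module 𝕜 M] where
  /-- the action `(m, a) ↦ m a` -/
  act : M →ₗ[𝕜] A →ₗ[𝕜] M
  act_mul : ∀ (m : M) (a b : A), act m (a * b) = act (act m a) b

/-- The linear map `f` is a homomorphism of right `A`-modules. -/
def IsRightModuleHom {𝕜 A M N : Type*} [Field 𝕜] [NonUnitalRing A] [Module 𝕜 A]
    [AddCommGroup M] [Module 𝕜 M] [AddCommGroup N] [Module 𝕜 N]
    (rM : AlgRightModule 𝕜 A M) (rN : AlgRightModule 𝕜 A N) (f : M →ₗ[𝕜] N) : Prop :=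
  ∀ (m : M) (a : A), f (rM.act m a) = rN.act (f m) a

/-- The span of all `m a ⊗ x - m ⊗ a x` in `M ⊗[𝕜] X`. -/
def balancedRelations {𝕜 A M X : Type*} [Field 𝕜] [NonUnitalRing A] [Module 𝕜 A]
    [AddCommGroup M] [Module 𝕜 M] [AddCommGroup X] [Module 𝕜 X]
    (rM : AlgRightModule 𝕜 A M) (lX : AlgLeftModule 𝕜 A X) : Submodule 𝕜 (M ⊗[𝕜] X) :=
  Submodule.span 𝕜
    {t | ∃ (m : M) (a : A) (x : X), t = rM.act m a ⊗ₜ[𝕜] x - m ⊗ₜ[𝕜] lX.act a x}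

/-- The tensor product `M ⊗_A X` of a right `A`-module and a left `A`-module. -/
abbrev BalancedTensor {𝕜 A M X : Type*} [Field 𝕜] [NonUnitalRing A] [Module 𝕜 A]
    [AddCommGroup M] [Module 𝕜 M] [AddCommGroup X] [Module 𝕜 X]
    (rM : AlgRightModule 𝕜 A M) (lX : AlgLeftModule 𝕜 A X) : Type _ :=
  (M ⊗[𝕜] X) ⧸ balancedRelations rM lX

/-- Helper fact: `f ⊗ I` respects the relations defining the tensor products over `A`. -/
theorem balancedRelations_le_comap {𝕜 A M N X : Type*} [Field 𝕜] [NonUnitalRing A] [Module 𝕜 A]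
    [AddCommGroup M] [Module 𝕜 M] [AddCommGroup N] [Module 𝕜 N] [AddCommGroup X] [Module 𝕜 X]
    {rM : AlgRightModule 𝕜 A M} {rN : AlgRightModule 𝕜 A N} (lX : AlgLeftModule 𝕜 A X)
    {f : M →ₗ[𝕜] N} (hf : IsRightModuleHom rM rN f) :
    balancedRelations rM lX ≤ (balancedRelations rN lX).comap (f.rTensor X) := by
  refine Submodule.span_le.2 ?_
  rintro _ ⟨m, a, x, rfl⟩
  refine Submodule.subset_span ⟨f m, a, x, ?_⟩
  simp [hf m a]

/-- The map `f ⊗ I : M ⊗_A X → N ⊗_A X` induced by a homomorphism `f` of right `A`-modules. -/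
def balancedMap {𝕜 A M N X : Type*} [Field 𝕜] [NonUnitalRing A] [Module 𝕜 A]
    [AddCommGroup M] [Module 𝕜 M] [AddCommGroup N] [Module 𝕜 N] [AddCommGroup X] [Module 𝕜 X]
    {rM : AlgRightModule 𝕜 A M} {rN : AlgRightModule 𝕜 A N} (lX : AlgLeftModule 𝕜 A X)
    {f : M →ₗ[𝕜] N} (hf : IsRightModuleHom rM rN f) :
    BalancedTensor rM lX →ₗ[𝕜] BalancedTensor rN lX :=
  Submodule.mapQ _ _ (f.rTensor X) (balancedRelations_le_comap lX hf)

/-- The left `A`-module `X` is flat: tensoring with `X` over `A` turns every short exact sequence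
`0 → M' → M → M'' → 0` of right `A`-modules into a short exact sequence. (All modules of the size
of the algebra are tested; this includes all right ideals of the unitization of `A`.) -/
def AlgLeftModule.IsFlat {𝕜 : Type u} {A : Type v} {X : Type w} [Field 𝕜] [NonUnitalRing A]
    [Module 𝕜 A] [AddCommGroup X] [Module 𝕜 X] (lX : AlgLeftModule 𝕜 A X) : Prop :=
  ∀ (M' M M'' : Type (max u v)) [AddCommGroup M'] [Module 𝕜 M'] [AddCommGroup M] [Module 𝕜 M]
    [AddCommGroup M''] [Module 𝕜 M'']
    (r' : AlgRightModule 𝕜 A M') (r : AlgRightModule 𝕜 A M) (r'' : AlgRightModule 𝕜 A M'')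
    (f : M' →ₗ[𝕜] M) (g : M →ₗ[𝕜] M'')
    (hf : IsRightModuleHom r' r f) (hg : IsRightModuleHom r r'' g),
    Function.Injective f → Function.Exact f g → Function.Surjective g →
      Function.Injective (balancedMap lX hf) ∧
      Function.Exact (balancedMap lX hf) (balancedMap lX hg) ∧
      Function.Surjective (balancedMap lX hg)

/-- A left ideal `J` of the algebra `B`, as a left `B`-module under multiplication. -/
def leftIdealModule {𝕜 B : Type*} [Field 𝕜] [NonUnitalRing B] [Module 𝕜 B]
    [IsScalarTower 𝕜 B B] [SMulCommClass 𝕜 B B] (J : Submodule 𝕜 B)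
    (hJ : ∀ (b : B), ∀ x ∈ J, b * x ∈ J) : AlgLeftModule 𝕜 B J where
  act := LinearMap.mk₂ 𝕜 (fun (b : B) (x : J) => (⟨b * x, hJ b x x.2⟩ : J))
    (fun a b x => Subtype.ext (add_mul a b (x : B)))
    (fun c a x => Subtype.ext (smul_mul_assoc c a (x : B)))
    (fun a x y => Subtype.ext (mul_add a (x : B) y))
    (fun c a x => Subtype.ext (mul_smul_comm c a (x : B)))
  mul_act a b x := Subtype.ext (mul_assoc a b (x : B))

/-- The algebra `A`, as a left module over itself. -/
def leftRegularModule (𝕜 A : Type*) [Field 𝕜] [NonUnitalRing A] [Module 𝕜 A]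
    [IsScalarTower 𝕜 A A] [SMulCommClass 𝕜 A A] : AlgLeftModule 𝕜 A A where
  act := LinearMap.mul 𝕜 A
  mul_act a b x := mul_assoc a b x

/-- The algebra `A` is left flat: it is flat as a left module over itself. -/
def IsLeftFlat (𝕜 A : Type*) [Field 𝕜] [NonUnitalRing A] [Module 𝕜 A]
    [IsScalarTower 𝕜 A A] [SMulCommClass 𝕜 A A] : Prop :=
  (leftRegularModule 𝕜 A).IsFlat

/-- The algebra `A` is left universally flat: whenever `A` is embedded (by `φ`) as a left ideal
in an algebra `B`, it is a flat left `B`-module. -/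
def IsLeftUniversallyFlat (𝕜 : Type u) (A : Type v) [Field 𝕜] [NonUnitalRing A] [Module 𝕜 A]
    [IsScalarTower 𝕜 A A] [SMulCommClass 𝕜 A A] : Prop :=
  ∀ (B : Type (max u v)) [NonUnitalRing B] [Module 𝕜 B] [IsScalarTower 𝕜 B B]
    [SMulCommClass 𝕜 B B] (φ : A →ₙₐ[𝕜] B), Function.Injective φ →
    ∀ hJ : ∀ (b : B), ∀ x ∈ LinearMap.range (φ : A →ₗ[𝕜] B), b * x ∈ LinearMap.range (φ : A →ₗ[𝕜] B),
      (leftIdealModule (LinearMap.range (φ : A →ₗ[𝕜] B)) hJ).IsFlat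

end Flatness

/-! ### Approximation property and approximable operators -/

section Operators

/-- The approximation property: the identity operator can be approximated by bounded operators of
finite rank, uniformly on compact sets. -/
def HasApproximationProperty (𝕜 X : Type*) [RCLike 𝕜] [NormedAddCommGroup X]
    [NormedSpace 𝕜 X] : Prop :=
  ∀ K : Set X, IsCompact K → ∀ ε : ℝ, 0 < ε →
    ∃ T : X →L[𝕜] X, FiniteDimensional 𝕜 (LinearMap.range (T : X →ₗ[𝕜] X)) ∧
      ∀ x ∈ K, ‖T x - x‖ ≤ ε

/-- The algebra of bounded operators of finite rank on `X`. -/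
def finiteRankOperators (𝕜 X : Type*) [RCLike 𝕜] [NormedAddCommGroup X] [NormedSpace 𝕜 X] :
    NonUnitalSubalgebra 𝕜 (X →L[𝕜] X) where
  carrier := {T | FiniteDimensional 𝕜 (LinearMap.range (T : X →ₗ[𝕜] X))}
  zero_mem' := by
    have h : LinearMap.range ((0 : X →L[𝕜] X) : X →ₗ[𝕜] X) = ⊥ := by
      ext y; simp
    simp only [Set.mem_ofPred_eq]
    rw [h]
    infer_instance
  add_mem' := by
    intro S T hS hT
    simp only [Set.mem_ofPred_eq] at hS hT ⊢
    refine Submodule.finiteDimensional_of_le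
      (S₂ := LinearMap.range (S : X →ₗ[𝕜] X) ⊔ LinearMap.range (T : X →ₗ[𝕜] X)) ?_
    rintro _ ⟨x, rfl⟩
    exact Submodule.add_mem_sup ⟨x, rfl⟩ ⟨x, rfl⟩
  mul_mem' := by
    intro S T hS _
    simp only [Set.mem_ofPred_eq] at hS ⊢
    refine Submodule.finiteDimensional_of_le (S₂ := LinearMap.range (S : X →ₗ[𝕜] X)) ?_
    rintro _ ⟨x, rfl⟩
    exact ⟨T x, rfl⟩
  smul_mem' := by
    intro c T hT
    simp only [Set.mem_ofPred_eq] at hT ⊢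
    refine Submodule.finiteDimensional_of_le (S₂ := LinearMap.range (T : X →ₗ[𝕜] X)) ?_
    rintro _ ⟨x, rfl⟩
    exact Submodule.smul_mem _ c ⟨x, rfl⟩

/-- The algebra `𝓕(X)`: the operator-norm closure of the finite rank operators on `X`. -/
def approximableOperators (𝕜 X : Type*) [RCLike 𝕜] [NormedAddCommGroup X] [NormedSpace 𝕜 X] :
    NonUnitalSubalgebra 𝕜 (X →L[𝕜] X) :=
  (finiteRankOperators 𝕜 X).topologicalClosure

end Operators

/-! ### The spaces of Johnson -/

section Johnson

/-- The distance `d(X, Y) = inf ‖T‖ ‖T⁻¹‖` over all isomorphisms `T` of `X` onto `Y`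
(it is `∞` if there are none). -/
noncomputable def isoDist (𝕜 X Y : Type*) [RCLike 𝕜] [NormedAddCommGroup X] [NormedSpace 𝕜 X]
    [NormedAddCommGroup Y] [NormedSpace 𝕜 Y] : ℝ≥0∞ :=
  ⨅ T : X ≃L[𝕜] Y, ‖(T : X →L[𝕜] Y)‖ₑ * ‖(T.symm : Y →L[𝕜] X)‖ₑ

/-- The sequences `(G i)` of finite dimensional spaces used to build the spaces `C_p`: they are
dense in the class of all finite dimensional spaces (each of which has an isometric copy in
`Type`), and each term is repeated infinitely often up to isometry. -/
structure IsJohnsonSequence (𝕜 : Type*) [RCLike 𝕜] (G : ℕ → Type*)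
    [∀ i, NormedAddCommGroup (G i)] [∀ i, NormedSpace 𝕜 (G i)] : Prop where
  finiteDimensional : ∀ i, FiniteDimensional 𝕜 (G i)
  dense : ∀ (X : Type) [NormedAddCommGroup X] [NormedSpace 𝕜 X] [FiniteDimensional 𝕜 X] (ε : ℝ),
    0 < ε → ∃ i, isoDist 𝕜 X (G i) < 1 + ENNReal.ofReal ε
  repeated : ∀ i, {j | j ≠ i ∧ Nonempty (G j ≃ₗᵢ[𝕜] G i)}.Infinite

/-- The `c₀` direct sum of the spaces `G i`, with the supremum norm. (The `ℓ_p` direct sum is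
`lp G p`.) -/
def c0Sum (𝕜 : Type*) [RCLike 𝕜] (G : ℕ → Type*) [∀ i, NormedAddCommGroup (G i)]
    [∀ i, NormedSpace 𝕜 (G i)] : Submodule 𝕜 (lp G ∞) where
  carrier := {f | Filter.Tendsto (fun i => ‖f i‖) Filter.atTop (𝓝 0)}
  zero_mem' := by simp
  add_mem' := by
    intro f g hf hg
    refine squeeze_zero (fun i => norm_nonneg _) (fun i => ?_) (by simpa using hf.add hg)
    exact norm_add_le (f i) (g i)
  smul_mem' := by
    intro c f hf
    have h := hf.const_mul ‖c‖
    simpa [norm_smul] using h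

/-- The space `E ⊕ C ⊕ C[0,1]` (with the maximum norm). -/
abbrev SumWithCI (𝕜 E C : Type*) [RCLike 𝕜] : Type _ :=
  E × C × C(unitInterval, 𝕜)

end Johnson

/-! ### Generalities on balanced tensor products -/

section BalancedTensors

/-- The equivalence of balanced tensor products over two algebras induced by an equivalence of the
left modules that matches the balancing relations. -/
noncomputable def balancedEquiv {𝕜 A B M X Y : Type*} [Field 𝕜] [NonUnitalRing A] [Module 𝕜 A]
    [NonUnitalRing B] [Module 𝕜 B] [AddCommGroup M] [Module 𝕜 M] [AddCommGroup X] [Module 𝕜 X]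
    [AddCommGroup Y] [Module 𝕜 Y] {rA : AlgRightModule 𝕜 A M} {rB : AlgRightModule 𝕜 B M}
    {lX : AlgLeftModule 𝕜 A X} {lY : AlgLeftModule 𝕜 B Y} (e : X ≃ₗ[𝕜] Y)
    (h : (balancedRelations rA lX).map (e.lTensor M : M ⊗[𝕜] X →ₗ[𝕜] M ⊗[𝕜] Y) =
      balancedRelations rB lY) :
    BalancedTensor rA lX ≃ₗ[𝕜] BalancedTensor rB lY :=
  Submodule.Quotient.equiv _ _ (e.lTensor M) h

theorem balancedEquiv_comp_balancedMap {𝕜 A B M N X Y : Type*} [Field 𝕜] [NonUnitalRing A]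
    [Module 𝕜 A] [NonUnitalRing B] [Module 𝕜 B] [AddCommGroup M] [Module 𝕜 M] [AddCommGroup N]
    [Module 𝕜 N] [AddCommGroup X] [Module 𝕜 X]
    [AddCommGroup Y] [Module 𝕜 Y] {rA : AlgRightModule 𝕜 A M} {rB : AlgRightModule 𝕜 B M}
    {sA : AlgRightModule 𝕜 A N} {sB : AlgRightModule 𝕜 B N}
    {lX : AlgLeftModule 𝕜 A X} {lY : AlgLeftModule 𝕜 B Y} (e : X ≃ₗ[𝕜] Y)
    (h : (balancedRelations rA lX).map (e.lTensor M : M ⊗[𝕜] X →ₗ[𝕜] M ⊗[𝕜] Y) =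
      balancedRelations rB lY)
    (h' : (balancedRelations sA lX).map (e.lTensor N : N ⊗[𝕜] X →ₗ[𝕜] N ⊗[𝕜] Y) =
      balancedRelations sB lY) {f : M →ₗ[𝕜] N}
    (hfA : IsRightModuleHom rA sA f) (hfB : IsRightModuleHom rB sB f) :
    (balancedMap lY hfB) ∘ₗ (balancedEquiv e h : _ →ₗ[𝕜] _) =
      (balancedEquiv e h' : _ →ₗ[𝕜] _) ∘ₗ (balancedMap lX hfA) := by
  refine Submodule.linearMap_qext _ (TensorProduct.ext' fun m x => ?_)
  rfl

/-- Exactness of a tensored sequence only depends on the balancing relations. -/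
theorem balanced_exact_congr {𝕜 A B M' M M'' X Y : Type*} [Field 𝕜] [NonUnitalRing A]
    [Module 𝕜 A] [NonUnitalRing B] [Module 𝕜 B] [AddCommGroup M'] [Module 𝕜 M'] [AddCommGroup M]
    [Module 𝕜 M] [AddCommGroup M''] [Module 𝕜 M''] [AddCommGroup X] [Module 𝕜 X]
    [AddCommGroup Y] [Module 𝕜 Y] {r'A : AlgRightModule 𝕜 A M'} {r'B : AlgRightModule 𝕜 B M'}
    {rA : AlgRightModule 𝕜 A M} {rB : AlgRightModule 𝕜 B M}
    {r''A : AlgRightModule 𝕜 A M''} {r''B : AlgRightModule 𝕜 B M''}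
    {lX : AlgLeftModule 𝕜 A X} {lY : AlgLeftModule 𝕜 B Y} (e : X ≃ₗ[𝕜] Y)
    (h' : (balancedRelations r'A lX).map (e.lTensor M' : M' ⊗[𝕜] X →ₗ[𝕜] M' ⊗[𝕜] Y) =
      balancedRelations r'B lY)
    (h : (balancedRelations rA lX).map (e.lTensor M : M ⊗[𝕜] X →ₗ[𝕜] M ⊗[𝕜] Y) =
      balancedRelations rB lY)
    (h'' : (balancedRelations r''A lX).map (e.lTensor M'' : M'' ⊗[𝕜] X →ₗ[𝕜] M'' ⊗[𝕜] Y) =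
      balancedRelations r''B lY) {f : M' →ₗ[𝕜] M} {g : M →ₗ[𝕜] M''}
    (hfA : IsRightModuleHom r'A rA f) (hfB : IsRightModuleHom r'B rB f)
    (hgA : IsRightModuleHom rA r''A g) (hgB : IsRightModuleHom rB r''B g)
    (H : Function.Injective (balancedMap lX hfA) ∧
      Function.Exact (balancedMap lX hfA) (balancedMap lX hgA) ∧
      Function.Surjective (balancedMap lX hgA)) :
    Function.Injective (balancedMap lY hfB) ∧
      Function.Exact (balancedMap lY hfB) (balancedMap lY hgB) ∧
      Function.Surjective (balancedMap lY hgB) := by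
  have c1 := balancedEquiv_comp_balancedMap e h' h hfA hfB
  have c2 := balancedEquiv_comp_balancedMap e h h'' hgA hgB
  refine ⟨?_, (Function.Exact.iff_of_ladder_linearEquiv c1 c2).2 H.2.1, ?_⟩
  · have : Function.Injective ((balancedMap lY hfB) ∘ₗ (balancedEquiv e h').toLinearMap) := by
      rw [c1]
      exact (balancedEquiv e h).injective.comp H.1
    rw [LinearMap.coe_comp] at this
    exact (Function.Injective.of_comp_iff' _ (balancedEquiv e h').bijective).1 this
  · have : Function.Surjective ((balancedMap lY hgB) ∘ₗ (balancedEquiv e h).toLinearMap) := by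
      rw [c2]
      exact (balancedEquiv e h'').surjective.comp H.2.2
    rw [LinearMap.coe_comp] at this
    exact this.of_comp

theorem map_balancedRelations {𝕜 A M X Y : Type*} [Field 𝕜] [NonUnitalRing A]
    [Module 𝕜 A] [AddCommGroup M] [Module 𝕜 M] [AddCommGroup X] [Module 𝕜 X]
    [AddCommGroup Y] [Module 𝕜 Y] (rA : AlgRightModule 𝕜 A M) (lX : AlgLeftModule 𝕜 A X)
    (e : X ≃ₗ[𝕜] Y) :
    (balancedRelations rA lX).map (e.lTensor M : M ⊗[𝕜] X →ₗ[𝕜] M ⊗[𝕜] Y) =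
      Submodule.span 𝕜 {t | ∃ (m : M) (a : A) (x : X),
        t = rA.act m a ⊗ₜ[𝕜] e x - m ⊗ₜ[𝕜] e (lX.act a x)} := by
  rw [balancedRelations, Submodule.map_span]
  congr 1
  ext t
  constructor
  · rintro ⟨_, ⟨m, a, x, rfl⟩, rfl⟩
    exact ⟨m, a, x, by simp⟩
  · rintro ⟨m, a, x, rfl⟩
    exact ⟨_, ⟨m, a, x, rfl⟩, by simp⟩

end BalancedTensors

section UniversalFlatness

/-- Restriction of a right module along a linear multiplicative map. -/
def AlgRightModule.restrict {𝕜 A B M : Type*} [Field 𝕜] [NonUnitalRing A] [Module 𝕜 A]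
    [NonUnitalRing B] [Module 𝕜 B] [AddCommGroup M] [Module 𝕜 M] (r : AlgRightModule 𝕜 B M)
    (φ : A →ₙₐ[𝕜] B) : AlgRightModule 𝕜 A M where
  act := r.act.compl₂ (φ : A →ₗ[𝕜] B)
  act_mul m a b := by simp [r.act_mul]

@[simp]
theorem AlgRightModule.restrict_act {𝕜 A B M : Type*} [Field 𝕜] [NonUnitalRing A] [Module 𝕜 A]
    [NonUnitalRing B] [Module 𝕜 B] [AddCommGroup M] [Module 𝕜 M] (r : AlgRightModule 𝕜 B M)
    (φ : A →ₙₐ[𝕜] B) (m : M) (a : A) : (r.restrict φ).act m a = r.act m (φ a) := rfl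

/-- A left flat algebra in which every element is a product is left universally flat. -/
theorem IsLeftFlat.isLeftUniversallyFlat {𝕜 : Type u} {A : Type v} [Field 𝕜] [NonUnitalRing A]
    [Module 𝕜 A] [IsScalarTower 𝕜 A A] [SMulCommClass 𝕜 A A] (h : IsLeftFlat 𝕜 A)
    (hmul : ∀ a : A, ∃ b c : A, a = b * c) : IsLeftUniversallyFlat 𝕜 A := by
  intro B _ _ _ _ φ hφ hJ M' M M'' _ _ _ _ _ _ r' r r'' f g hf hg hfi hfg hgs
  let e : A ≃ₗ[𝕜] LinearMap.range (φ : A →ₗ[𝕜] B) := LinearEquiv.ofInjective (φ : A →ₗ[𝕜] B) hφ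
  have key : ∀ (N : Type (max u v)) [AddCommGroup N] [Module 𝕜 N] (s : AlgRightModule 𝕜 B N),
      (balancedRelations (s.restrict φ) (leftRegularModule 𝕜 A)).map
        (e.lTensor N : N ⊗[𝕜] A →ₗ[𝕜] N ⊗[𝕜] LinearMap.range (φ : A →ₗ[𝕜] B)) =
      balancedRelations s (leftIdealModule (LinearMap.range (φ : A →ₗ[𝕜] B)) hJ) := by
    intro N _ _ s
    have hact : ∀ a x : A, e (a * x) = (leftIdealModule (LinearMap.range (φ : A →ₗ[𝕜] B)) hJ).act
        (φ a) (e x) := fun a x => Subtype.ext (map_mul φ a x)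
    rw [map_balancedRelations]
    apply le_antisymm
    · refine Submodule.span_le.2 ?_
      rintro _ ⟨m, a, x, rfl⟩
      exact Submodule.subset_span ⟨m, φ a, e x, by rw [← hact]; rfl⟩
    · refine Submodule.span_le.2 ?_
      rintro _ ⟨m, b, y, rfl⟩
      obtain ⟨a, rfl⟩ := e.surjective y
      obtain ⟨c, d, rfl⟩ := hmul a
      obtain ⟨k, hk⟩ := hJ b (φ c) ⟨c, rfl⟩
      replace hk : φ k = b * φ c := hk
      have e1 : (leftIdealModule (LinearMap.range (φ : A →ₗ[𝕜] B)) hJ).act b (e (c * d)) =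
          e (k * d) := by
        refine Subtype.ext ?_
        change b * φ (c * d) = φ (k * d)
        rw [map_mul, map_mul, hk, mul_assoc]
      rw [e1]
      have h1 : (s.restrict φ).act (s.act m b) c ⊗ₜ[𝕜] e d - s.act m b ⊗ₜ[𝕜] e (c * d) ∈
          Submodule.span 𝕜 {t | ∃ (m : N) (a : A) (x : A), t = (s.restrict φ).act m a ⊗ₜ[𝕜] e x -
            m ⊗ₜ[𝕜] e ((leftRegularModule 𝕜 A).act a x)} :=
        Submodule.subset_span ⟨_, c, d, rfl⟩
      have h2 : (s.restrict φ).act m k ⊗ₜ[𝕜] e d - m ⊗ₜ[𝕜] e (k * d) ∈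
          Submodule.span 𝕜 {t | ∃ (m : N) (a : A) (x : A), t = (s.restrict φ).act m a ⊗ₜ[𝕜] e x -
            m ⊗ₜ[𝕜] e ((leftRegularModule 𝕜 A).act a x)} :=
        Submodule.subset_span ⟨m, k, d, rfl⟩
      have h3 : (s.restrict φ).act (s.act m b) c = (s.restrict φ).act m k := by
        simp [hk, s.act_mul]
      rw [h3] at h1
      have h4 := Submodule.sub_mem _ h2 h1
      rw [sub_sub_sub_cancel_left] at h4
      exact h4
  have hom : ∀ {N P : Type (max u v)} [AddCommGroup N] [Module 𝕜 N] [AddCommGroup P] [Module 𝕜 P]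
      {s : AlgRightModule 𝕜 B N} {t : AlgRightModule 𝕜 B P} {k : N →ₗ[𝕜] P},
      IsRightModuleHom s t k → IsRightModuleHom (s.restrict φ) (t.restrict φ) k :=
    fun hk m a => hk m (φ a)
  exact balanced_exact_congr e (key M' r') (key M r) (key M'' r'') (hom hf) hf (hom hg) hg
    (h M' M M'' _ _ _ f g (hom hf) (hom hg) hfi hfg hgs)

/-- A left universally flat algebra is left flat. -/
theorem IsLeftUniversallyFlat.isLeftFlat {𝕜 : Type u} {A : Type v} [Field 𝕜] [NonUnitalRing A]
    [Module 𝕜 A] [IsScalarTower 𝕜 A A] [SMulCommClass 𝕜 A A] (h : IsLeftUniversallyFlat 𝕜 A) :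
    IsLeftFlat 𝕜 A := by
  have : IsScalarTower 𝕜 (ULift.{u} A) (ULift.{u} A) :=
    ⟨fun c a b => ULift.ext _ _ (smul_mul_assoc c a.down b.down)⟩
  have : SMulCommClass 𝕜 (ULift.{u} A) (ULift.{u} A) :=
    ⟨fun c a b => ULift.ext _ _ (mul_smul_comm c a.down b.down).symm⟩
  let φ : A →ₙₐ[𝕜] ULift.{u} A :=
    { toFun := ULift.up
      map_smul' := fun _ _ => rfl
      map_zero' := rfl
      map_add' := fun _ _ => rfl
      map_mul' := fun _ _ => rfl }
  let ψ : ULift.{u} A →ₙₐ[𝕜] A :=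
    { toFun := ULift.down
      map_smul' := fun _ _ => rfl
      map_zero' := rfl
      map_add' := fun _ _ => rfl
      map_mul' := fun _ _ => rfl }
  have hφ : Function.Injective φ := ULift.up_injective
  have hJ : ∀ (b : ULift.{u} A), ∀ x ∈ LinearMap.range (φ : A →ₗ[𝕜] ULift.{u} A),
      b * x ∈ LinearMap.range (φ : A →ₗ[𝕜] ULift.{u} A) := fun b x _ => ⟨(b * x).down, rfl⟩
  intro M' M M'' _ _ _ _ _ _ r' r r'' f g hf hg hfi hfg hgs
  let e : LinearMap.range (φ : A →ₗ[𝕜] ULift.{u} A) ≃ₗ[𝕜] A :=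
    (LinearEquiv.ofInjective (φ : A →ₗ[𝕜] ULift.{u} A) hφ).symm
  have he : ∀ y, e y = (y : ULift.{u} A).down := fun y => by
    obtain ⟨a, rfl⟩ := (LinearEquiv.ofInjective (φ : A →ₗ[𝕜] ULift.{u} A) hφ).surjective y
    rw [LinearEquiv.symm_apply_apply]
    rfl
  have key : ∀ (N : Type (max u v)) [AddCommGroup N] [Module 𝕜 N] (s : AlgRightModule 𝕜 A N),
      (balancedRelations (s.restrict ψ)
        (leftIdealModule (LinearMap.range (φ : A →ₗ[𝕜] ULift.{u} A)) hJ)).map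
        (e.lTensor N : N ⊗[𝕜] LinearMap.range (φ : A →ₗ[𝕜] ULift.{u} A) →ₗ[𝕜] N ⊗[𝕜] A) =
      balancedRelations s (leftRegularModule 𝕜 A) := by
    intro N _ _ s
    rw [map_balancedRelations, balancedRelations]
    congr 1
    ext t
    constructor
    · rintro ⟨m, a, x, rfl⟩
      exact ⟨m, a.down, e x, by rw [he, he]; rfl⟩
    · rintro ⟨m, a, x, rfl⟩
      exact ⟨m, ULift.up a, ⟨ULift.up x, x, rfl⟩, by rw [he, he]; rfl⟩
  have hom : ∀ {N P : Type (max u v)} [AddCommGroup N] [Module 𝕜 N] [AddCommGroup P] [Module 𝕜 P]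
      {s : AlgRightModule 𝕜 A N} {t : AlgRightModule 𝕜 A P} {k : N →ₗ[𝕜] P},
      IsRightModuleHom s t k → IsRightModuleHom (s.restrict ψ) (t.restrict ψ) k :=
    fun hk m a => hk m (ψ a)
  exact balanced_exact_congr e (key M' r') (key M r) (key M'' r'') (hom hf) hf (hom hg) hg
    (h (ULift.{u} A) φ hφ hJ M' M M'' _ _ _ f g (hom hf) (hom hg) hfi hfg hgs)

end UniversalFlatness

section RightExactness

theorem balancedMap_mk {𝕜 A M N X : Type*} [Field 𝕜] [NonUnitalRing A] [Module 𝕜 A]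
    [AddCommGroup M] [Module 𝕜 M] [AddCommGroup N] [Module 𝕜 N] [AddCommGroup X] [Module 𝕜 X]
    {rM : AlgRightModule 𝕜 A M} {rN : AlgRightModule 𝕜 A N} (lX : AlgLeftModule 𝕜 A X)
    {f : M →ₗ[𝕜] N} (hf : IsRightModuleHom rM rN f) (t : M ⊗[𝕜] X) :
    balancedMap lX hf ((balancedRelations rM lX).mkQ t) =
      (balancedRelations rN lX).mkQ (f.rTensor X t) := rfl

theorem balancedRelations_le_map {𝕜 A M N X : Type*} [Field 𝕜] [NonUnitalRing A] [Module 𝕜 A]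
    [AddCommGroup M] [Module 𝕜 M] [AddCommGroup N] [Module 𝕜 N] [AddCommGroup X] [Module 𝕜 X]
    {rM : AlgRightModule 𝕜 A M} {rN : AlgRightModule 𝕜 A N} (lX : AlgLeftModule 𝕜 A X)
    {f : M →ₗ[𝕜] N} (hf : IsRightModuleHom rM rN f) (hs : Function.Surjective f) :
    balancedRelations rN lX ≤ (balancedRelations rM lX).map (f.rTensor X) := by
  refine Submodule.span_le.2 ?_
  rintro _ ⟨n, a, x, rfl⟩
  obtain ⟨m, rfl⟩ := hs n
  exact ⟨_, Submodule.subset_span ⟨m, a, x, rfl⟩, by simp [hf m a]⟩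

theorem balancedMap_surjective {𝕜 A M N X : Type*} [Field 𝕜] [NonUnitalRing A] [Module 𝕜 A]
    [AddCommGroup M] [Module 𝕜 M] [AddCommGroup N] [Module 𝕜 N] [AddCommGroup X] [Module 𝕜 X]
    {rM : AlgRightModule 𝕜 A M} {rN : AlgRightModule 𝕜 A N} (lX : AlgLeftModule 𝕜 A X)
    {f : M →ₗ[𝕜] N} (hf : IsRightModuleHom rM rN f) (hs : Function.Surjective f) :
    Function.Surjective (balancedMap lX hf) := by
  intro y
  obtain ⟨t, rfl⟩ := (balancedRelations rN lX).mkQ_surjective y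
  obtain ⟨s, rfl⟩ := LinearMap.rTensor_surjective X hs t
  exact ⟨(balancedRelations rM lX).mkQ s, rfl⟩

/-- Tensoring with a left module is right exact. -/
theorem balancedMap_exact {𝕜 A M' M M'' X : Type*} [Field 𝕜] [NonUnitalRing A] [Module 𝕜 A]
    [AddCommGroup M'] [Module 𝕜 M'] [AddCommGroup M] [Module 𝕜 M] [AddCommGroup M'']
    [Module 𝕜 M''] [AddCommGroup X] [Module 𝕜 X]
    {r' : AlgRightModule 𝕜 A M'} {r : AlgRightModule 𝕜 A M} {r'' : AlgRightModule 𝕜 A M''}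
    (lX : AlgLeftModule 𝕜 A X) {f : M' →ₗ[𝕜] M} {g : M →ₗ[𝕜] M''}
    (hf : IsRightModuleHom r' r f) (hg : IsRightModuleHom r r'' g)
    (hfg : Function.Exact f g) (hs : Function.Surjective g) :
    Function.Exact (balancedMap lX hf) (balancedMap lX hg) := by
  have hex : Function.Exact (f.rTensor X) (g.rTensor X) := rTensor_exact X hfg hs
  intro y
  obtain ⟨t, rfl⟩ := (balancedRelations r lX).mkQ_surjective y
  constructor
  · intro h
    rw [balancedMap_mk, Submodule.mkQ_apply, Submodule.Quotient.mk_eq_zero] at h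
    obtain ⟨ρ, hρ, hρ'⟩ := balancedRelations_le_map lX hg hs h
    obtain ⟨s, hs⟩ := (hex (t - ρ)).1 (by rw [map_sub, hρ', sub_self])
    refine ⟨(balancedRelations r' lX).mkQ s, ?_⟩
    rw [balancedMap_mk, hs, map_sub, sub_eq_self]
    simpa using hρ
  · rintro ⟨z, hz⟩
    obtain ⟨s, rfl⟩ := (balancedRelations r' lX).mkQ_surjective z
    rw [← hz, balancedMap_mk, balancedMap_mk, (hex _).2 ⟨s, rfl⟩, map_zero]

end RightExactness

section Kernels

/-- A submodule of a right module. -/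
def AlgRightModule.submodule {𝕜 A M : Type*} [Field 𝕜] [NonUnitalRing A] [Module 𝕜 A]
    [AddCommGroup M] [Module 𝕜 M] (r : AlgRightModule 𝕜 A M) (N : Submodule 𝕜 M)
    (hN : ∀ m ∈ N, ∀ a, r.act m a ∈ N) : AlgRightModule 𝕜 A N where
  act := LinearMap.mk₂ 𝕜 (fun (m : N) (a : A) => (⟨r.act m a, hN m m.2 a⟩ : N))
    (fun m m' a => Subtype.ext (by simp)) (fun c m a => Subtype.ext (by simp))
    (fun m a b => Subtype.ext (by simp)) (fun c m a => Subtype.ext (by simp))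
  act_mul m a b := Subtype.ext (r.act_mul m a b)

/-- A quotient of a right module. -/
def AlgRightModule.quotient {𝕜 A M : Type*} [Field 𝕜] [NonUnitalRing A] [Module 𝕜 A]
    [AddCommGroup M] [Module 𝕜 M] (r : AlgRightModule 𝕜 A M) (N : Submodule 𝕜 M)
    (hN : ∀ m ∈ N, ∀ a, r.act m a ∈ N) : AlgRightModule 𝕜 A (M ⧸ N) where
  act := N.liftQ
    { toFun := fun m => N.mkQ ∘ₗ r.act m
      map_add' := fun m m' => by ext; simp
      map_smul' := fun c m => by ext; simp }
    (fun m hm => by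
      ext a
      simpa using hN m hm a)
  act_mul m a b := by
    obtain ⟨m, rfl⟩ := N.mkQ_surjective m
    exact congrArg N.mkQ (r.act_mul m a b)

/-- Tensoring with a flat left module preserves kernels. -/
theorem AlgLeftModule.IsFlat.exists_ker {𝕜 : Type u} {A : Type v} {X : Type w} [Field 𝕜]
    [NonUnitalRing A] [Module 𝕜 A] [AddCommGroup X] [Module 𝕜 X] {lX : AlgLeftModule 𝕜 A X}
    (h : lX.IsFlat) {P Q : Type (max u v)} [AddCommGroup P] [Module 𝕜 P] [AddCommGroup Q]
    [Module 𝕜 Q] {rP : AlgRightModule 𝕜 A P} {rQ : AlgRightModule 𝕜 A Q} {f : P →ₗ[𝕜] Q}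
    (hf : IsRightModuleHom rP rQ f) (t : P ⊗[𝕜] X)
    (ht : f.rTensor X t ∈ balancedRelations rQ lX) :
    ∃ s : LinearMap.ker f ⊗[𝕜] X,
      t - (LinearMap.ker f).subtype.rTensor X s ∈ balancedRelations rP lX := by
  have hK : ∀ m ∈ LinearMap.ker f, ∀ a, rP.act m a ∈ LinearMap.ker f := fun m hm a => by
    rw [LinearMap.mem_ker] at hm ⊢
    rw [hf m a, hm, map_zero, LinearMap.zero_apply]
  have hR : ∀ m ∈ LinearMap.range f, ∀ a, rQ.act m a ∈ LinearMap.range f := by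
    rintro _ ⟨m, rfl⟩ a
    exact ⟨rP.act m a, hf m a⟩
  have h1 : IsRightModuleHom (rP.submodule _ hK) rP (LinearMap.ker f).subtype := fun _ _ => rfl
  have h2 : IsRightModuleHom rP (rQ.submodule _ hR) f.rangeRestrict :=
    fun m a => Subtype.ext (hf m a)
  have h3 : IsRightModuleHom (rQ.submodule _ hR) rQ (LinearMap.range f).subtype := fun _ _ => rfl
  have h4 : IsRightModuleHom rQ (rQ.quotient _ hR) (LinearMap.range f).mkQ := fun _ _ => rfl
  have hinj := (h _ _ _ _ _ _ _ _ h3 h4 (Submodule.subtype_injective _)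
    (LinearMap.exact_subtype_mkQ _) (Submodule.mkQ_surjective _)).1
  have hex := balancedMap_exact lX h1 h2 (by
    intro x
    rw [← LinearMap.mem_ker, LinearMap.ker_rangeRestrict]
    simp) f.surjective_rangeRestrict
  obtain ⟨z, hz⟩ := (hex ((balancedRelations rP lX).mkQ t)).1 (by
    apply hinj
    rw [balancedMap_mk, balancedMap_mk, ← LinearMap.rTensor_comp_apply,
      show (LinearMap.range f).subtype ∘ₗ f.rangeRestrict = f from rfl, map_zero]
    simpa using ht)
  obtain ⟨s, rfl⟩ := (balancedRelations _ lX).mkQ_surjective z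
  refine ⟨s, ?_⟩
  rw [balancedMap_mk] at hz
  rw [← Submodule.Quotient.mk_eq_zero, Submodule.Quotient.mk_sub, sub_eq_zero]
  exact hz.symm

/-- In a left flat algebra, every solution of the equation `r * a = 0` is a combination of
solutions in the unitization. -/
theorem IsLeftFlat.mem_span_of_mul_eq_zero {𝕜 : Type u} {A : Type v} [Field 𝕜] [NonUnitalRing A]
    [Module 𝕜 A] [IsScalarTower 𝕜 A A] [SMulCommClass 𝕜 A A] (h : IsLeftFlat 𝕜 A) {r a : A}
    (hra : r * a = 0) :
    (a : Unitization 𝕜 A) ∈ Submodule.span 𝕜 {x : Unitization 𝕜 A |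
      ∃ (m : Unitization 𝕜 A) (b : A), (r : Unitization 𝕜 A) * m = 0 ∧ x = m * b} := by
  let R : AlgRightModule 𝕜 A (Unitization 𝕜 A) :=
    { act := (LinearMap.mul 𝕜 (Unitization 𝕜 A)).compl₂ (Unitization.inrHom 𝕜 𝕜 A)
      act_mul := fun m a b => by simp [mul_assoc] }
  have hR : ∀ m a, R.act m a = m * (a : Unitization 𝕜 A) := fun _ _ => rfl
  let f : Unitization 𝕜 A →ₗ[𝕜] Unitization 𝕜 A := LinearMap.mulLeft 𝕜 (r : Unitization 𝕜 A)
  have hf : IsRightModuleHom R R f := fun m a => by simp [hR, f, mul_assoc]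
  let μ : Unitization 𝕜 A ⊗[𝕜] A →ₗ[𝕜] Unitization 𝕜 A := TensorProduct.lift R.act
  have hμ : balancedRelations R (leftRegularModule 𝕜 A) ≤ LinearMap.ker μ := by
    refine Submodule.span_le.2 ?_
    rintro _ ⟨m, a, x, rfl⟩
    have e : (leftRegularModule 𝕜 A).act a x = a * x := rfl
    simp [μ, hR, mul_assoc, e]
  obtain ⟨s, hs⟩ := AlgLeftModule.IsFlat.exists_ker h hf ((1 : Unitization 𝕜 A) ⊗ₜ[𝕜] a) (by
    refine Submodule.subset_span ⟨1, r, a, ?_⟩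
    have e : (leftRegularModule 𝕜 A).act r a = 0 := hra
    rw [e]
    simp [hR, f])
  replace hs := hμ hs
  rw [LinearMap.mem_ker, map_sub, sub_eq_zero] at hs
  have e : μ ((1 : Unitization 𝕜 A) ⊗ₜ[𝕜] a) = a := by simp [μ, hR]
  rw [← e, hs]
  clear hs
  induction s using TensorProduct.induction_on with
  | zero => simp
  | tmul n x => exact Submodule.subset_span ⟨n, x, n.2, by simp [μ, hR]⟩
  | add x y hx hy => rw [map_add, map_add]; exact Submodule.add_mem _ hx hy

/-- In a left flat subalgebra, every solution of the equation `r * a = 0` is a combination of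
solutions in the ambient unital algebra. -/
theorem IsLeftFlat.mem_span_of_mul_eq_zero_subalgebra {𝕜 D : Type*} [Field 𝕜] [Ring D]
    [Algebra 𝕜 D] {A : NonUnitalSubalgebra 𝕜 D} (h : IsLeftFlat 𝕜 A) {r a : A} (hra : r * a = 0) :
    (a : D) ∈ Submodule.span 𝕜 {x : D | ∃ (m : D) (b : A), (r : D) * m = 0 ∧ x = m * b} := by
  let op := NonUnitalSubalgebra.unitization A
  have hop : ∀ b : A, op (b : Unitization 𝕜 A) = b := fun b => by simp [op]
  have h1 := Submodule.mem_map_of_mem (f := op.toLinearMap) (h.mem_span_of_mul_eq_zero hra)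
  rw [Submodule.map_span, AlgHom.toLinearMap_apply, hop] at h1
  refine Submodule.span_mono ?_ h1
  rintro _ ⟨_, ⟨m, b, hm, rfl⟩, rfl⟩
  refine ⟨op m, b, ?_, ?_⟩
  · rw [← hop, ← map_mul, hm, map_zero]
  · rw [AlgHom.toLinearMap_apply, map_mul, hop]

end Kernels

section Criterion

/-- A factorization criterion for left flatness: every finite set of elements has a common right
factor, in such a way that the left factors satisfy the same relations. -/
theorem isLeftFlat_of_factorization {𝕜 : Type u} {A : Type v} [Field 𝕜] [NonUnitalRing A]
    [Module 𝕜 A] [IsScalarTower 𝕜 A A] [SMulCommClass 𝕜 A A]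
    (h : ∀ S : Set A, S.Finite → ∃ (v : A) (Φ : A →ₗ[𝕜] A), ∀ a ∈ S, Φ a * v = a ∧
      ∀ c : A, c * a ∈ S → Φ (c * a) = c * Φ a) : IsLeftFlat 𝕜 A := by
  intro M' M M'' _ _ _ _ _ _ r' r r'' f g hf hg hfi hfg hgs
  refine ⟨?_, balancedMap_exact _ hf hg hfg hgs, balancedMap_surjective _ hg hgs⟩
  rw [injective_iff_map_eq_zero]
  intro y hy
  obtain ⟨t, rfl⟩ := (balancedRelations r' (leftRegularModule 𝕜 A)).mkQ_surjective y
  rw [balancedMap_mk, Submodule.mkQ_apply, Submodule.Quotient.mk_eq_zero] at hy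
  have h1 : ∀ t : M' ⊗[𝕜] A, ∃ S : Set A, S.Finite ∧ ∀ (v : A) (Φ : A →ₗ[𝕜] A),
      (∀ a ∈ S, Φ a * v = a) →
      t - TensorProduct.lift (r'.act.compl₂ Φ) t ⊗ₜ[𝕜] v ∈
        balancedRelations r' (leftRegularModule 𝕜 A) := by
    intro t
    induction t using TensorProduct.induction_on with
    | zero => exact ⟨∅, Set.finite_empty, fun v Φ _ => by simp⟩
    | tmul m a =>
      refine ⟨{a}, Set.finite_singleton a, fun v Φ hΦ => ?_⟩
      rw [← Submodule.neg_mem_iff]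
      refine Submodule.subset_span ⟨m, Φ a, v, ?_⟩
      have e : (leftRegularModule 𝕜 A).act (Φ a) v = a := hΦ a rfl
      rw [e]
      simp
    | add x y hx hy =>
      obtain ⟨S, hS, hx⟩ := hx
      obtain ⟨T, hT, hy⟩ := hy
      refine ⟨S ∪ T, hS.union hT, fun v Φ hΦ => ?_⟩
      have := Submodule.add_mem _ (hx v Φ fun a ha => hΦ a (Or.inl ha))
        (hy v Φ fun a ha => hΦ a (Or.inr ha))
      rw [map_add, TensorProduct.add_tmul]
      rwa [sub_add_sub_comm] at this
  have h2 : ∀ τ ∈ balancedRelations r (leftRegularModule 𝕜 A), ∃ S : Set A, S.Finite ∧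
      ∀ (Φ : A →ₗ[𝕜] A), (∀ a ∈ S, ∀ c : A, c * a ∈ S → Φ (c * a) = c * Φ a) →
      TensorProduct.lift (r.act.compl₂ Φ) τ = 0 := by
    intro τ hτ
    refine Submodule.span_induction ?_ ?_ ?_ ?_ hτ
    · rintro _ ⟨m, c, x, rfl⟩
      refine ⟨{x, c * x}, by simp, fun Φ hΦ => ?_⟩
      have e : (leftRegularModule 𝕜 A).act c x = c * x := rfl
      rw [e]
      simp [hΦ x (by simp) c (by simp), r.act_mul]
    · exact ⟨∅, Set.finite_empty, fun Φ _ => by simp⟩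
    · rintro x y - - ⟨S, hS, hx⟩ ⟨T, hT, hy⟩
      refine ⟨S ∪ T, hS.union hT, fun Φ hΦ => ?_⟩
      rw [map_add, hx Φ fun a ha c hc => hΦ a (Or.inl ha) c (Or.inl hc),
        hy Φ fun a ha c hc => hΦ a (Or.inr ha) c (Or.inr hc), add_zero]
    · rintro k x - ⟨S, hS, hx⟩
      exact ⟨S, hS, fun Φ hΦ => by rw [map_smul, hx Φ hΦ, smul_zero]⟩
  obtain ⟨S, hS, h1⟩ := h1 t
  obtain ⟨T, hT, h2⟩ := h2 _ hy
  obtain ⟨v, Φ, hΦ⟩ := h (S ∪ T) (hS.union hT)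
  specialize h1 v Φ fun a ha => (hΦ a (Or.inl ha)).1
  specialize h2 Φ fun a ha c hc => (hΦ a (Or.inr ha)).2 c (Or.inr hc)
  have h3 : f ∘ₗ TensorProduct.lift (r'.act.compl₂ Φ) =
      TensorProduct.lift (r.act.compl₂ Φ) ∘ₗ f.rTensor A :=
    TensorProduct.ext' fun m a => by simp [hf m (Φ a)]
  have h4 : TensorProduct.lift (r'.act.compl₂ Φ) t = 0 := by
    apply hfi
    have := LinearMap.congr_fun h3 t
    rw [LinearMap.comp_apply, LinearMap.comp_apply, h2] at this
    rw [this, map_zero]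
  rw [h4, TensorProduct.zero_tmul, sub_zero] at h1
  simpa using h1

end Criterion

/-! ### Approximable operators between two spaces -/

section Approximable

variable {𝕜 : Type*} [RCLike 𝕜] {W X Y Z : Type*} [NormedAddCommGroup W] [NormedSpace 𝕜 W]
  [NormedAddCommGroup X] [NormedSpace 𝕜 X]
  [NormedAddCommGroup Y] [NormedSpace 𝕜 Y] [NormedAddCommGroup Z] [NormedSpace 𝕜 Z]

variable (𝕜 X Y) in
/-- The bounded finite rank operators from `X` to `Y`. -/
def finiteRankMaps : Submodule 𝕜 (X →L[𝕜] Y) where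
  carrier := {T | FiniteDimensional 𝕜 (LinearMap.range (T : X →ₗ[𝕜] Y))}
  zero_mem' := by
    have h : LinearMap.range ((0 : X →L[𝕜] Y) : X →ₗ[𝕜] Y) = ⊥ := by
      ext y; simp
    simp only [Set.mem_ofPred_eq]
    rw [h]
    infer_instance
  add_mem' := by
    intro S T hS hT
    simp only [Set.mem_ofPred_eq] at hS hT ⊢
    refine Submodule.finiteDimensional_of_le
      (S₂ := LinearMap.range (S : X →ₗ[𝕜] Y) ⊔ LinearMap.range (T : X →ₗ[𝕜] Y)) ?_
    rintro _ ⟨x, rfl⟩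
    exact Submodule.add_mem_sup ⟨x, rfl⟩ ⟨x, rfl⟩
  smul_mem' := by
    intro c T hT
    simp only [Set.mem_ofPred_eq] at hT ⊢
    refine Submodule.finiteDimensional_of_le (S₂ := LinearMap.range (T : X →ₗ[𝕜] Y)) ?_
    rintro _ ⟨x, rfl⟩
    exact Submodule.smul_mem _ c ⟨x, rfl⟩

variable (𝕜 X Y) in
/-- The approximable operators from `X` to `Y`: the closure of the finite rank operators. -/
def approximableMaps : Submodule 𝕜 (X →L[𝕜] Y) := (finiteRankMaps 𝕜 X Y).topologicalClosure

theorem mem_finiteRankMaps {T : X →L[𝕜] Y} :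
    T ∈ finiteRankMaps 𝕜 X Y ↔ FiniteDimensional 𝕜 (LinearMap.range (T : X →ₗ[𝕜] Y)) := Iff.rfl

theorem isClosed_approximableMaps : IsClosed (approximableMaps 𝕜 X Y : Set (X →L[𝕜] Y)) :=
  Submodule.isClosed_topologicalClosure _

theorem finiteRankMaps_le_approximableMaps : finiteRankMaps 𝕜 X Y ≤ approximableMaps 𝕜 X Y :=
  Submodule.le_topologicalClosure _

theorem comp_mem_finiteRankMaps (S : Y →L[𝕜] Z) {T : X →L[𝕜] Y} (hT : T ∈ finiteRankMaps 𝕜 X Y) :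
    S ∘L T ∈ finiteRankMaps 𝕜 X Z := by
  rw [mem_finiteRankMaps] at hT ⊢
  refine Submodule.finiteDimensional_of_le
    (S₂ := (LinearMap.range (T : X →ₗ[𝕜] Y)).map (S : Y →ₗ[𝕜] Z)) ?_
  rintro _ ⟨x, rfl⟩
  exact ⟨T x, ⟨x, rfl⟩, rfl⟩

theorem finiteRankMaps_comp {S : Y →L[𝕜] Z} (hS : S ∈ finiteRankMaps 𝕜 Y Z) (T : X →L[𝕜] Y) :
    S ∘L T ∈ finiteRankMaps 𝕜 X Z := by
  rw [mem_finiteRankMaps] at hS ⊢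
  refine Submodule.finiteDimensional_of_le (S₂ := (LinearMap.range (S : Y →ₗ[𝕜] Z))) ?_
  rintro _ ⟨x, rfl⟩
  exact ⟨T x, rfl⟩

theorem comp_mem_approximableMaps (S : Y →L[𝕜] Z) {T : X →L[𝕜] Y}
    (hT : T ∈ approximableMaps 𝕜 X Y) : S ∘L T ∈ approximableMaps 𝕜 X Z :=
  map_mem_closure ((ContinuousLinearMap.compL 𝕜 X Y Z) S).continuous hT
    fun _ h => comp_mem_finiteRankMaps S h

theorem approximableMaps_comp {S : Y →L[𝕜] Z} (hS : S ∈ approximableMaps 𝕜 Y Z) (T : X →L[𝕜] Y) :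
    S ∘L T ∈ approximableMaps 𝕜 X Z :=
  map_mem_closure (f := fun S : Y →L[𝕜] Z => S ∘L T)
    ((ContinuousLinearMap.compL 𝕜 X Y Z).flip T).continuous hS
    fun _ h => finiteRankMaps_comp h T

theorem smulRight_mem_finiteRankMaps (φ : StrongDual 𝕜 X) (y : Y) :
    φ.smulRight y ∈ finiteRankMaps 𝕜 X Y := by
  rw [mem_finiteRankMaps]
  refine Submodule.finiteDimensional_of_le (S₂ := Submodule.span 𝕜 {y}) ?_
  rintro _ ⟨x, rfl⟩
  exact Submodule.smul_mem _ _ (Submodule.mem_span_singleton_self y)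

theorem mem_finiteRankMaps_of_domain [FiniteDimensional 𝕜 X] (T : X →L[𝕜] Y) :
    T ∈ finiteRankMaps 𝕜 X Y := by
  rw [mem_finiteRankMaps]
  infer_instance

/-- The finite rank operators are spanned by the operators of rank one. -/
theorem finiteRankMaps_le {N : Submodule 𝕜 (X →L[𝕜] Y)}
    (h : ∀ (φ : StrongDual 𝕜 X) (y : Y), φ.smulRight y ∈ N) : finiteRankMaps 𝕜 X Y ≤ N := by
  intro T hT
  rw [mem_finiteRankMaps] at hT
  let b := Module.finBasis 𝕜 (LinearMap.range (T : X →ₗ[𝕜] Y))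
  let T' : X →L[𝕜] LinearMap.range (T : X →ₗ[𝕜] Y) := T.codRestrict _ fun x => ⟨x, rfl⟩
  have : T = ∑ i, ((LinearMap.toContinuousLinearMap (b.coord i)) ∘L T').smulRight (b i : Y) := by
    ext x
    have := congrArg Subtype.val (b.sum_repr (T' x))
    rw [sum_apply]
    refine this.symm.trans ?_
    rw [Submodule.coe_sum]
    rfl
  rw [this]
  exact Submodule.sum_mem _ fun i _ => h _ _

theorem approximableMaps_le {N : Submodule 𝕜 (X →L[𝕜] Y)} (hN : IsClosed (N : Set (X →L[𝕜] Y)))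
    (h : ∀ (φ : StrongDual 𝕜 X) (y : Y), φ.smulRight y ∈ N) : approximableMaps 𝕜 X Y ≤ N :=
  Submodule.topologicalClosure_minimal _ (finiteRankMaps_le h) hN

/-- If `R i` are uniformly bounded and `φ ∘ R i → φ` in norm for every functional `φ`, then
`T ∘ R i → T` for every approximable operator `T`. -/
theorem tendsto_approximableMaps_comp {α : Type*} {l : Filter α} {R : α → X →L[𝕜] X} {M : ℝ}
    (hM0 : 0 ≤ M) (hM : ∀ i, ‖R i‖ ≤ M)
    (h : ∀ φ : StrongDual 𝕜 X, Filter.Tendsto (fun i => φ ∘L R i) l (𝓝 φ))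
    {T : X →L[𝕜] Y} (hT : T ∈ approximableMaps 𝕜 X Y) :
    Filter.Tendsto (fun i => T ∘L R i) l (𝓝 T) := by
  let N : Submodule 𝕜 (X →L[𝕜] Y) :=
    { carrier := {T | Filter.Tendsto (fun i => T ∘L R i) l (𝓝 T)}
      zero_mem' := by
        simp only [Set.mem_ofPred_eq, ContinuousLinearMap.zero_comp]
        exact tendsto_const_nhds
      add_mem' := fun {S T} hS hT => by
        simpa [ContinuousLinearMap.add_comp] using Filter.Tendsto.add hS hT
      smul_mem' := fun c T hT => by
        simpa [ContinuousLinearMap.smul_comp] using Filter.Tendsto.const_smul hT c }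
  refine approximableMaps_le (N := N) ?_ ?_ hT
  · refine isClosed_of_closure_subset fun S hS => ?_
    change Filter.Tendsto _ _ _
    rw [Metric.tendsto_nhds]
    intro ε hε
    obtain ⟨S', hS', hd⟩ := Metric.mem_closure_iff.1 hS (ε / (2 * (M + 1))) (by positivity)
    filter_upwards [Metric.tendsto_nhds.1 hS' (ε / 2) (by positivity)] with n h1
    have e : S ∘L R n - S = (S - S') ∘L R n + (S' ∘L R n - S') - (S - S') := by
      rw [ContinuousLinearMap.sub_comp]; abel
    rw [dist_eq_norm] at hd h1 ⊢
    have h2 : ‖(S - S') ∘L R n‖ ≤ ‖S - S'‖ * M :=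
      (ContinuousLinearMap.opNorm_comp_le _ _).trans (by gcongr; exact hM n)
    have h3 : ‖S - S'‖ * (M + 1) < ε / 2 := by
      calc ‖S - S'‖ * (M + 1) < ε / (2 * (M + 1)) * (M + 1) := by gcongr
        _ = ε / 2 := by field_simp
    rw [e]
    have h4 := norm_sub_le ((S - S') ∘L R n + (S' ∘L R n - S')) (S - S')
    have h5 := norm_add_le ((S - S') ∘L R n) (S' ∘L R n - S')
    linarith
  · intro φ y
    change Filter.Tendsto _ _ _
    have e : ∀ i, φ.smulRight y ∘L R i = (φ ∘L R i).smulRight y := fun i => by ext; simp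
    simp only [e]
    exact ((ContinuousLinearMap.smulRightL 𝕜 X Y).flip y).continuous.tendsto φ |>.comp (h φ)

/-- The linear map taking an operator to its adjoint. -/
noncomputable def adjointMap (𝕜 X Z : Type*) [RCLike 𝕜] [NormedAddCommGroup X] [NormedSpace 𝕜 X]
    [NormedAddCommGroup Z] [NormedSpace 𝕜 Z] :
    (X →L[𝕜] Z) →L[𝕜] StrongDual 𝕜 Z →L[𝕜] StrongDual 𝕜 X :=
  (ContinuousLinearMap.compL 𝕜 X Z 𝕜).flip

@[simp]
theorem adjointMap_apply (T : X →L[𝕜] Z) (f : StrongDual 𝕜 Z) :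
    adjointMap 𝕜 X Z T f = f ∘L T := rfl

theorem adjointMap_smulRight (φ : StrongDual 𝕜 X) (z : Z) :
    adjointMap 𝕜 X Z (φ.smulRight z) = (ContinuousLinearMap.apply 𝕜 𝕜 z).smulRight φ := by
  ext f x
  exact (map_smul f (φ x) z).trans (mul_comm _ _)

/-- The adjoint of a bounded finite rank operator has finite rank. -/
theorem adjointMap_mem_finiteRankMaps {T : X →L[𝕜] Z} (hT : T ∈ finiteRankMaps 𝕜 X Z) :
    adjointMap 𝕜 X Z T ∈ finiteRankMaps 𝕜 (StrongDual 𝕜 Z) (StrongDual 𝕜 X) := by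
  refine finiteRankMaps_le (N := (finiteRankMaps 𝕜 _ _).comap (adjointMap 𝕜 X Z).toLinearMap)
    (fun φ e => ?_) hT
  rw [Submodule.mem_comap, ContinuousLinearMap.coe_coe, adjointMap_smulRight]
  exact smulRight_mem_finiteRankMaps _ _

theorem adjointMap_mem_approximableMaps {T : X →L[𝕜] Z} (hT : T ∈ approximableMaps 𝕜 X Z) :
    adjointMap 𝕜 X Z T ∈ approximableMaps 𝕜 (StrongDual 𝕜 Z) (StrongDual 𝕜 X) :=
  map_mem_closure (adjointMap 𝕜 X Z).continuous hT fun _ h => adjointMap_mem_finiteRankMaps h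

end Approximable

section Lifting

variable (𝕜 : Type*) [RCLike 𝕜] (X : Type*) [NormedAddCommGroup X] [NormedSpace 𝕜 X]

/-- Approximable operators on `X` with values in a closed subspace are approximable as operators
into that subspace. -/
def HasApproximableCorestriction : Prop :=
  ∀ (Z : Type w) [NormedAddCommGroup Z] [NormedSpace 𝕜 Z] [CompleteSpace Z] (Y : Submodule 𝕜 Z)
    (_ : IsClosed (Y : Set Z)) (T : X →L[𝕜] Z) (_ : T ∈ approximableMaps 𝕜 X Z)
    (hTY : ∀ x, T x ∈ Y), T.codRestrict Y hTY ∈ approximableMaps 𝕜 X Y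

variable {𝕜 X}

/-- It suffices that there are uniformly bounded approximable operators whose adjoints converge
strongly to the identity. -/
theorem hasApproximableCorestriction_of_tendsto {α : Type*} {l : Filter α} [l.NeBot]
    {R : α → X →L[𝕜] X} (hR : ∀ i, R i ∈ approximableMaps 𝕜 X X) {M : ℝ} (hM0 : 0 ≤ M)
    (hM : ∀ i, ‖R i‖ ≤ M)
    (h : ∀ φ : StrongDual 𝕜 X, Filter.Tendsto (fun i => φ ∘L R i) l (𝓝 φ)) :
    HasApproximableCorestriction.{w} 𝕜 X := by
  intro Z _ _ _ Y hY T hT hTY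
  refine isClosed_approximableMaps.mem_of_tendsto (f := fun i => T.codRestrict Y hTY ∘L R i)
    (b := l) ?_ (Filter.Eventually.of_forall fun i => comp_mem_approximableMaps _ (hR i))
  have h1 := tendsto_approximableMaps_comp hM0 hM h hT
  rw [tendsto_iff_norm_sub_tendsto_zero] at h1 ⊢
  refine squeeze_zero (fun _ => norm_nonneg _) (fun i => ?_) h1
  exact ContinuousLinearMap.opNorm_le_bound _ (norm_nonneg _) fun x =>
    (T ∘L R i - T).le_opNorm x

theorem HasApproximableCorestriction.prod {X₁ X₂ : Type*} [NormedAddCommGroup X₁]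
    [NormedSpace 𝕜 X₁] [NormedAddCommGroup X₂] [NormedSpace 𝕜 X₂]
    (h₁ : HasApproximableCorestriction.{w} 𝕜 X₁) (h₂ : HasApproximableCorestriction.{w} 𝕜 X₂) :
    HasApproximableCorestriction.{w} 𝕜 (X₁ × X₂) := by
  intro Z _ _ _ Y hY T hT hTY
  have e : T.codRestrict Y hTY =
      ((T ∘L ContinuousLinearMap.inl 𝕜 X₁ X₂).codRestrict Y fun x => hTY _) ∘L
        ContinuousLinearMap.fst 𝕜 X₁ X₂ +
      ((T ∘L ContinuousLinearMap.inr 𝕜 X₁ X₂).codRestrict Y fun x => hTY _) ∘L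
        ContinuousLinearMap.snd 𝕜 X₁ X₂ := by
    refine ContinuousLinearMap.ext fun x => Subtype.ext ?_
    change T x = T (x.1, 0) + T (0, x.2)
    rw [← map_add]
    simp
  rw [e]
  exact Submodule.add_mem _
    (approximableMaps_comp (h₁ Z Y hY _ (approximableMaps_comp hT _) _) _)
    (approximableMaps_comp (h₂ Z Y hY _ (approximableMaps_comp hT _) _) _)

end Lifting

/-! ### Factorization through sums of finite dimensional spaces -/

section Factorization

variable {𝕜 : Type*} [RCLike 𝕜] {G : ℕ → Type*} [∀ i, NormedAddCommGroup (G i)]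
  [∀ i, NormedSpace 𝕜 (G i)]

theorem small_of_finiteDimensional (𝕜 W : Type*) [RCLike 𝕜] [AddCommGroup W] [Module 𝕜 W]
    [FiniteDimensional 𝕜 W] : Small.{0} W := by
  have : Small.{0} 𝕜 := small_of_injective (β := ℝ × ℝ)
    (f := fun z : 𝕜 => (RCLike.re z, RCLike.im z)) fun z w h =>
      RCLike.ext (congrArg Prod.fst h) (congrArg Prod.snd h)
  exact small_of_injective (Module.finBasis 𝕜 W).equivFun.injective

theorem IsJohnsonSequence.frequently_exists_equiv (hG : IsJohnsonSequence 𝕜 G) (W : Type*)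
    [NormedAddCommGroup W] [NormedSpace 𝕜 W] [FiniteDimensional 𝕜 W] :
    ∃ᶠ i in Filter.atTop, ∃ θ : W ≃L[𝕜] G i,
      ‖(θ : W →L[𝕜] G i)‖ * ‖(θ.symm : G i →L[𝕜] W)‖ ≤ 2 := by
  have : Small.{0} W := small_of_finiteDimensional 𝕜 W
  let l : Shrink.{0} W ≃ₗ[𝕜] W := Shrink.linearEquiv 𝕜 W
  let e : Shrink.{0} W ≃ₗᵢ[𝕜] W := ⟨l, fun _ => rfl⟩
  have : FiniteDimensional 𝕜 (Shrink.{0} W) := l.symm.finiteDimensional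
  obtain ⟨i, hi⟩ := hG.dense (Shrink.{0} W) 1 one_pos
  obtain ⟨T, hT⟩ := iInf_lt_iff.1 hi
  rw [← ofReal_norm, ← ofReal_norm, ← ENNReal.ofReal_mul (norm_nonneg _), ← ENNReal.ofReal_one,
    ← ENNReal.ofReal_add zero_le_one zero_le_one, ENNReal.ofReal_lt_ofReal_iff (by norm_num)] at hT
  rw [Nat.frequently_atTop_iff_infinite]
  refine (hG.repeated i).mono ?_
  rintro j ⟨-, ⟨g⟩⟩
  refine ⟨(e.symm.toContinuousLinearEquiv.trans T).trans g.symm.toContinuousLinearEquiv, ?_⟩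
  have h1 : ‖(((e.symm.toContinuousLinearEquiv.trans T).trans
      g.symm.toContinuousLinearEquiv : W ≃L[𝕜] G j) : W →L[𝕜] G j)‖ ≤
      ‖(T : Shrink.{0} W →L[𝕜] G i)‖ := by
    refine ContinuousLinearMap.opNorm_le_bound _ (norm_nonneg _) fun x => ?_
    have := (T : Shrink.{0} W →L[𝕜] G i).le_opNorm (e.symm x)
    rw [e.symm.norm_map] at this
    refine le_trans (le_of_eq ?_) this
    exact g.symm.norm_map _
  have h2 : ‖(((e.symm.toContinuousLinearEquiv.trans T).trans
      g.symm.toContinuousLinearEquiv : W ≃L[𝕜] G j).symm : G j →L[𝕜] W)‖ ≤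
      ‖(T.symm : G i →L[𝕜] Shrink.{0} W)‖ := by
    refine ContinuousLinearMap.opNorm_le_bound _ (norm_nonneg _) fun x => ?_
    have := (T.symm : G i →L[𝕜] Shrink.{0} W).le_opNorm (g x)
    rw [g.norm_map] at this
    refine le_trans (le_of_eq ?_) this
    exact e.norm_map _
  have h3 := mul_le_mul h1 h2 (norm_nonneg _) (norm_nonneg _)
  linarith

theorem IsJohnsonSequence.frequently_factor (hG : IsJohnsonSequence 𝕜 G) {X Y : Type*}
    [NormedAddCommGroup X] [NormedSpace 𝕜 X] [NormedAddCommGroup Y] [NormedSpace 𝕜 Y]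
    {a : X →L[𝕜] Y} (ha : a ∈ finiteRankMaps 𝕜 X Y) {δ : ℝ} (hδ : 0 < δ) :
    ∃ᶠ i in Filter.atTop, ∃ (v : X →L[𝕜] G i) (u : G i →L[𝕜] Y), u ∘L v = a ∧ ‖u‖ ≤ δ ∧
      ‖v‖ ≤ 2 * ‖a‖ / δ := by
  rw [mem_finiteRankMaps] at ha
  refine (hG.frequently_exists_equiv (LinearMap.range (a : X →ₗ[𝕜] Y))).mono ?_
  rintro i ⟨θ, hθ⟩
  let W := LinearMap.range (a : X →ₗ[𝕜] Y)
  let a' : X →L[𝕜] W := a.codRestrict _ fun x => ⟨x, rfl⟩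
  have ha' : ‖a'‖ ≤ ‖a‖ := ContinuousLinearMap.opNorm_le_bound _ (norm_nonneg _) a.le_opNorm
  set s : ℝ := ‖(θ.symm : G i →L[𝕜] W)‖ with hs
  rcases (norm_nonneg (θ.symm : G i →L[𝕜] W)).eq_or_lt with h0 | h0
  · have h0' : (θ.symm : G i →L[𝕜] W) = 0 := norm_eq_zero.1 h0.symm
    have ha0 : a = 0 := by
      ext x
      have h1 : a' x = (θ.symm : G i →L[𝕜] W) (θ (a' x)) := (θ.symm_apply_apply _).symm
      rw [h0'] at h1
      exact congrArg Subtype.val h1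
    exact ⟨0, 0, by simp [ha0], by simpa using hδ.le, by simp [ha0]⟩
  · rw [← hs] at h0
    let α : ℝ := δ / s
    have hα : 0 < α := div_pos hδ h0
    have hα' : (α : 𝕜) ≠ 0 := RCLike.ofReal_ne_zero.2 hα.ne'
    refine ⟨(α : 𝕜)⁻¹ • ((θ : W →L[𝕜] G i) ∘L a'),
      (α : 𝕜) • (W.subtypeL ∘L (θ.symm : G i →L[𝕜] W)), ?_, ?_, ?_⟩
    · ext x
      simp only [ContinuousLinearMap.smul_comp, ContinuousLinearMap.comp_smul, smul_smul,
        inv_mul_cancel₀ hα', one_smul]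
      exact congrArg Subtype.val (θ.symm_apply_apply (a' x))
    · rw [norm_smul, RCLike.norm_ofReal, abs_of_pos hα]
      have : ‖W.subtypeL ∘L (θ.symm : G i →L[𝕜] W)‖ ≤ s :=
        ContinuousLinearMap.opNorm_le_bound _ h0.le fun x =>
          (θ.symm : G i →L[𝕜] W).le_opNorm x
      calc α * ‖W.subtypeL ∘L (θ.symm : G i →L[𝕜] W)‖ ≤ α * s := by gcongr
        _ = δ := div_mul_cancel₀ _ h0.ne'
    · rw [norm_smul, norm_inv, RCLike.norm_ofReal, abs_of_pos hα]
      calc α⁻¹ * ‖(θ : W →L[𝕜] G i) ∘L a'‖ ≤ α⁻¹ * (‖(θ : W →L[𝕜] G i)‖ * ‖a'‖) := by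
            gcongr; exact ContinuousLinearMap.opNorm_comp_le _ _
        _ = (‖(θ : W →L[𝕜] G i)‖ * s) * ‖a'‖ / δ := by
            simp only [α, inv_div]; ring
        _ ≤ 2 * ‖a‖ / δ := by gcongr

/-- Contractive coordinate embeddings and projections of a sum `C` of the spaces `G i`. -/
structure CoordinateSystem (𝕜 : Type*) [RCLike 𝕜] (G : ℕ → Type*) [∀ i, NormedAddCommGroup (G i)]
    [∀ i, NormedSpace 𝕜 (G i)] (C : Type*) [NormedAddCommGroup C] [NormedSpace 𝕜 C] where
  /-- the coordinate embeddings -/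
  ι : ∀ i, G i →L[𝕜] C
  /-- the coordinate projections -/
  π : ∀ i, C →L[𝕜] G i
  π_ι_same : ∀ i x, π i (ι i x) = x
  π_ι_ne : ∀ i j x, i ≠ j → π j (ι i x) = 0
  norm_ι_le : ∀ i, ‖ι i‖ ≤ 1
  norm_π_le : ∀ i, ‖π i‖ ≤ 1

/-- Every approximable operator is a product of two approximable operators, through any sum of the
spaces of a Johnson sequence. -/
theorem CoordinateSystem.exists_factor (hG : IsJohnsonSequence 𝕜 G) {C : Type*}
    [NormedAddCommGroup C] [NormedSpace 𝕜 C] [CompleteSpace C] (s : CoordinateSystem 𝕜 G C)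
    {X Y : Type*} [NormedAddCommGroup X] [NormedSpace 𝕜 X] [NormedAddCommGroup Y]
    [NormedSpace 𝕜 Y] [CompleteSpace Y] {T : X →L[𝕜] Y} (hT : T ∈ approximableMaps 𝕜 X Y) :
    ∃ v ∈ approximableMaps 𝕜 X C, ∃ u ∈ approximableMaps 𝕜 C Y, u ∘L v = T := by
  have := hG.finiteDimensional
  obtain ⟨a, haT, ha, -, ha'⟩ := controlled_sum_of_mem_closure
    (s := (finiteRankMaps 𝕜 X Y).toAddSubgroup) hT (b := fun n => (1 / 4 : ℝ) ^ n)
    (fun n => by positivity)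
  obtain ⟨i, hi, hvu⟩ := Filter.extraction_forall_of_frequently fun n =>
    hG.frequently_factor (ha n) (δ := (1 / 2 : ℝ) ^ n) (by positivity)
  choose v u huv hu hv using hvu
  have hsu : Summable fun n => ‖u n ∘L s.π (i n)‖ := by
    refine Summable.of_nonneg_of_le (fun n => norm_nonneg _) (fun n => ?_)
      (summable_geometric_of_lt_one (r := (1 / 2 : ℝ)) (by norm_num) (by norm_num))
    refine (ContinuousLinearMap.opNorm_comp_le _ _).trans ?_
    calc ‖u n‖ * ‖s.π (i n)‖ ≤ (1 / 2 : ℝ) ^ n * 1 := by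
          gcongr
          exacts [hu n, s.norm_π_le _]
      _ = _ := mul_one _
  have hvn : ∀ n, 0 < n → ‖v n‖ ≤ 2 * (1 / 2 : ℝ) ^ n := fun n hn => by
    refine (hv n).trans ?_
    rw [div_le_iff₀ (by positivity), mul_assoc, ← mul_pow]
    have := (ha' n hn).le
    norm_num at this ⊢
    linarith
  have hsv : Summable fun n => ‖s.ι (i n) ∘L v n‖ := by
    rw [← summable_nat_add_iff 1]
    refine Summable.of_nonneg_of_le (fun n => norm_nonneg _) (fun n => ?_)
      ((summable_nat_add_iff 1).2 ((summable_geometric_of_lt_one (r := (1 / 2 : ℝ)) (by norm_num)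
        (by norm_num)).mul_left 2))
    refine (ContinuousLinearMap.opNorm_comp_le _ _).trans ?_
    calc ‖s.ι (i (n + 1))‖ * ‖v (n + 1)‖ ≤ 1 * (2 * (1 / 2 : ℝ) ^ (n + 1)) := by
          gcongr
          exacts [s.norm_ι_le _, hvn _ n.succ_pos]
      _ = _ := one_mul _
  have hU := hsu.of_norm.hasSum
  have hV := hsv.of_norm.hasSum
  set U : C →L[𝕜] Y := ∑' n, u n ∘L s.π (i n)
  set V : X →L[𝕜] C := ∑' n, s.ι (i n) ∘L v n
  have hUι : ∀ m, U ∘L s.ι (i m) = u m := by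
    intro m
    refine HasSum.unique (hU.mapL ((ContinuousLinearMap.compL 𝕜 (G (i m)) C Y).flip
      (s.ι (i m)))) ?_
    convert hasSum_single m ?_ using 1
    · ext x
      simp [s.π_ι_same]
    · intro n hn
      ext x
      simp [s.π_ι_ne _ _ _ (fun h => hn (hi.injective h).symm)]
  refine ⟨V, ?_, U, ?_, ?_⟩
  · exact tsum_mem isClosed_approximableMaps fun n =>
      finiteRankMaps_le_approximableMaps (finiteRankMaps_comp (mem_finiteRankMaps_of_domain _) _)
  · exact tsum_mem isClosed_approximableMaps fun n =>
      finiteRankMaps_le_approximableMaps (finiteRankMaps_comp (mem_finiteRankMaps_of_domain _) _)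
  · have h1 := hV.mapL (ContinuousLinearMap.compL 𝕜 X C Y U)
    have h2 : (fun n => ContinuousLinearMap.compL 𝕜 X C Y U (s.ι (i n) ∘L v n)) = a := by
      funext n
      rw [← huv n, ← hUι n]
      rfl
    rw [h2] at h1
    exact tendsto_nhds_unique (h1.tendsto_sum_nat.comp (Filter.tendsto_add_atTop_nat 1)) haT

end Factorization

section Sums

variable {𝕜 : Type*} [RCLike 𝕜] {G : ℕ → Type*} [∀ i, NormedAddCommGroup (G i)]
  [∀ i, NormedSpace 𝕜 (G i)]

/-- The coordinates of the `ℓ_p` sum. -/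
noncomputable def lpCoordinates (p : ℝ≥0∞) [Fact (1 ≤ p)] : CoordinateSystem 𝕜 G (lp G p) where
  ι := lp.singleContinuousLinearMap 𝕜 G p
  π := lp.evalCLM 𝕜 G p
  π_ι_same i x := lp.single_apply_self p i x
  π_ι_ne i j x h := lp.single_apply_ne p i x h.symm
  norm_ι_le i := ContinuousLinearMap.opNorm_le_bound _ zero_le_one fun x => by
    simp [lp.norm_single (lt_of_lt_of_le one_pos (Fact.out : 1 ≤ p))]
  norm_π_le i := ContinuousLinearMap.opNorm_le_bound _ zero_le_one fun x => by
    rw [one_mul]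
    exact lp.norm_apply_le_norm (lt_of_lt_of_le one_pos (Fact.out : 1 ≤ p)).ne' x i

theorem single_mem_c0Sum (i : ℕ) (x : G i) : lp.single ∞ i x ∈ c0Sum 𝕜 G := by
  refine tendsto_const_nhds.congr' ?_
  filter_upwards [Filter.eventually_gt_atTop i] with j hj
  rw [lp.single_apply_ne ∞ i x hj.ne', norm_zero]

/-- The coordinates of the `c₀` sum. -/
noncomputable def c0Coordinates : CoordinateSystem 𝕜 G (c0Sum 𝕜 G) where
  ι i := (lp.singleContinuousLinearMap 𝕜 G ∞ i).codRestrict _ (single_mem_c0Sum i)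
  π i := lp.evalCLM 𝕜 G ∞ i ∘L (c0Sum 𝕜 G).subtypeL
  π_ι_same := (lpCoordinates (𝕜 := 𝕜) ∞).π_ι_same
  π_ι_ne := (lpCoordinates (𝕜 := 𝕜) ∞).π_ι_ne
  norm_ι_le i := ContinuousLinearMap.opNorm_le_bound _ zero_le_one fun x =>
    ((lpCoordinates (𝕜 := 𝕜) ∞).ι i).le_of_opNorm_le ((lpCoordinates ∞).norm_ι_le i) x
  norm_π_le i := ContinuousLinearMap.opNorm_le_bound _ zero_le_one fun x =>
    ((lpCoordinates (𝕜 := 𝕜) ∞).π i).le_of_opNorm_le ((lpCoordinates ∞).norm_π_le i) (x : lp G ∞)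

theorem isClosed_c0Sum : IsClosed (c0Sum 𝕜 G : Set (lp G ∞)) := by
  refine isClosed_of_closure_subset fun f hf => ?_
  change Filter.Tendsto _ _ _
  rw [Metric.tendsto_atTop]
  intro ε hε
  obtain ⟨g, hg, hd⟩ := Metric.mem_closure_iff.1 hf (ε / 2) (by positivity)
  obtain ⟨N, hN⟩ := Metric.tendsto_atTop.1 (show Filter.Tendsto (fun i => ‖g i‖) _ _ from hg)
    (ε / 2) (by positivity)
  refine ⟨N, fun n hn => ?_⟩
  have h1 := hN n hn
  rw [dist_zero_right, norm_norm] at h1 ⊢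
  rw [dist_eq_norm] at hd
  have h2 := lp.norm_apply_le_norm (by simp) (f - g) n
  rw [lp.coeFn_sub, Pi.sub_apply] at h2
  have h3 := norm_sub_norm_le (f n) (g n)
  linarith

theorem completeSpace_lp (hG : IsJohnsonSequence 𝕜 G) (p : ℝ≥0∞) [Fact (1 ≤ p)] :
    CompleteSpace (lp G p) := by
  have := hG.finiteDimensional
  have : ∀ i, CompleteSpace (G i) := fun i => FiniteDimensional.complete 𝕜 (G i)
  infer_instance

theorem completeSpace_c0Sum (hG : IsJohnsonSequence 𝕜 G) : CompleteSpace (c0Sum 𝕜 G) := by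
  have := completeSpace_lp hG ∞
  exact isClosed_c0Sum.completeSpace_coe

end Sums

/-! ### Operators into spaces of continuous functions defined by null families of functionals -/

section Bumps

variable {𝕜 : Type*} [RCLike 𝕜]

theorem exists_disjoint_bumps (𝕜 K : Type*) [RCLike 𝕜] [TopologicalSpace K] [CompactSpace K]
    [T2Space K] [Infinite K] :
    ∃ (φ : ℕ → C(K, 𝕜)) (t : ℕ → K), (∀ n, φ n (t n) = 1) ∧ (∀ n x, ‖φ n x‖ ≤ 1) ∧
      ∀ n m x, φ n x ≠ 0 → φ m x ≠ 0 → n = m := by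
  obtain ⟨U, hUi, hUo, hUd⟩ := exists_seq_infinite_isOpen_pairwise_disjoint K
  choose t ht using fun n => (hUi n).nonempty
  choose f hf0 hf1 hf using fun n => exists_continuous_zero_one_of_isClosed
    (hUo n).isClosed_compl (isClosed_singleton (x := t n)) (by simpa using ht n)
  have hU : ∀ n x, ((f n x : ℝ) : 𝕜) ≠ 0 → x ∈ U n := fun n x h => by
    by_contra hx
    exact h (by rw [hf0 n hx]; simp)
  refine ⟨fun n => ⟨fun x => ((f n x : ℝ) : 𝕜), by fun_prop⟩, t, fun n => ?_, fun n x => ?_,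
    fun n m x hn hm => ?_⟩
  · simp [hf1 n rfl]
  · simpa [abs_of_nonneg (hf n x).1] using (hf n x).2
  · by_contra hnm
    exact Set.disjoint_left.1 (hUd hnm) (hU n x hn) (hU m x hm)

/-- A null family of functionals on `Z` defines an approximable operator into `C(K)`. -/
theorem exists_approximableMaps_eval {K : Type*} [TopologicalSpace K] [CompactSpace K] [T2Space K]
    [Infinite K] {Z : Type*} [NormedAddCommGroup Z] [NormedSpace 𝕜 Z] {ι : Type*} [Countable ι]
    (γ : ι → StrongDual 𝕜 Z) (hγ : ∀ δ : ℝ, 0 < δ → {i | δ ≤ ‖γ i‖}.Finite) :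
    ∃ B ∈ approximableMaps 𝕜 Z C(K, 𝕜), ∃ t : ι → K, (∀ i z, B z (t i) = γ i z) ∧
      ∀ z, (∀ i, γ i z = 0) → B z = 0 := by
  obtain ⟨φ, t, hφt, hφ, hφd⟩ := exists_disjoint_bumps 𝕜 K
  obtain ⟨e, he⟩ := exists_injective_nat ι
  have hsum : Summable fun i => (γ i).smulRight (φ (e i)) := by
    rw [summable_iff_vanishing_norm]
    intro ε hε
    refine ⟨(hγ (ε / 2) (by positivity)).toFinset, fun T hT => ?_⟩
    refine lt_of_le_of_lt ?_ (half_lt_self hε)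
    refine ContinuousLinearMap.opNorm_le_bound _ (by positivity) fun z => ?_
    refine (ContinuousMap.norm_le _ (by positivity)).2 fun x => ?_
    have e1 : (∑ i ∈ T, (γ i).smulRight (φ (e i))) z x = ∑ i ∈ T, γ i z * φ (e i) x := by
      simp [sum_apply]
    rw [e1]
    by_cases h : ∃ i ∈ T, φ (e i) x ≠ 0
    · obtain ⟨i, hi, hix⟩ := h
      rw [Finset.sum_eq_single_of_mem i hi fun j _ hj => by
        by_contra hne
        exact hj (he (hφd _ _ x (right_ne_zero_of_mul hne) hix)), norm_mul]
      have h1 : ‖γ i‖ < ε / 2 := by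
        have := Finset.disjoint_left.1 hT hi
        simpa using this
      calc ‖γ i z‖ * ‖φ (e i) x‖ ≤ ‖γ i z‖ * 1 := by gcongr; exact hφ _ _
        _ ≤ ‖γ i‖ * ‖z‖ := by rw [mul_one]; exact (γ i).le_opNorm z
        _ ≤ ε / 2 * ‖z‖ := by gcongr
    · push Not at h
      rw [Finset.sum_eq_zero fun i hi => by rw [h i hi, mul_zero], norm_zero]
      positivity
  refine ⟨∑' i, (γ i).smulRight (φ (e i)), ?_, t ∘ e, fun i z => ?_, fun z hz => ?_⟩
  · exact tsum_mem isClosed_approximableMaps fun i =>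
      finiteRankMaps_le_approximableMaps (smulRight_mem_finiteRankMaps _ _)
  · have h1 := (hsum.hasSum.mapL (ContinuousLinearMap.apply 𝕜 C(K, 𝕜) z)).mapL
      (ContinuousMap.evalCLM 𝕜 (t (e i)))
    refine h1.unique ?_
    convert hasSum_single i ?_ using 1
    · simp [hφt]
    · intro j hj
      have : φ (e j) (t (e i)) = 0 := by
        by_contra hne
        exact hj (he (hφd _ _ _ hne (by rw [hφt]; exact one_ne_zero)))
      simp [this]
  · have h1 := hsum.hasSum.mapL (ContinuousLinearMap.apply 𝕜 C(K, 𝕜) z)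
    refine h1.unique ?_
    convert hasSum_zero with i
    simp [hz i]

/-- A closed subspace of a separable space is the kernel of an approximable operator. -/
theorem exists_approximableMaps_ker_eq (K : Type*) [TopologicalSpace K] [CompactSpace K] [T2Space K]
    [Infinite K] {Z : Type*} [NormedAddCommGroup Z] [NormedSpace 𝕜 Z] [SecondCountableTopology Z]
    (Y : Submodule 𝕜 Z) (hY : IsClosed (Y : Set Z)) :
    ∃ B ∈ approximableMaps 𝕜 Z C(K, 𝕜), ∀ z, B z = 0 ↔ z ∈ Y := by
  let ι := {ψ : StrongDual 𝕜 Z // ∀ y ∈ Y, ψ y = 0}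
  obtain ⟨T, hT, hTU⟩ := TopologicalSpace.isOpen_iUnion_countable
    (fun ψ : ι => {z : Z | ψ.1 z ≠ 0}) fun ψ => isOpen_ne.preimage ψ.1.continuous
  have : Countable T := hT
  obtain ⟨e, he⟩ := exists_injective_nat T
  have hpos : ∀ ψ : T, 0 < ((1 / 2 : ℝ) ^ e ψ * (1 + ‖ψ.1.1‖)⁻¹) := fun ψ => by positivity
  obtain ⟨B, hB, t, hBt, hB0⟩ := exists_approximableMaps_eval (K := K)
    (fun ψ : T => (((1 / 2 : ℝ) ^ e ψ * (1 + ‖ψ.1.1‖)⁻¹ : ℝ) : 𝕜) • ψ.1.1) (fun δ hδ => by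
      obtain ⟨N, hN⟩ := exists_pow_lt_of_lt_one hδ (by norm_num : (1 / 2 : ℝ) < 1)
      refine Set.Finite.subset ((Set.finite_lt_nat N).preimage he.injOn) fun ψ hψ => ?_
      by_contra hlt
      have hlt : N ≤ e ψ := not_lt.1 hlt
      have h1 : δ ≤ (1 / 2 : ℝ) ^ e ψ * (1 + ‖ψ.1.1‖)⁻¹ * ‖ψ.1.1‖ := by
        have : δ ≤ ‖(((1 / 2 : ℝ) ^ e ψ * (1 + ‖ψ.1.1‖)⁻¹ : ℝ) : 𝕜) • ψ.1.1‖ := hψ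
        rwa [norm_smul, RCLike.norm_ofReal, abs_of_pos (hpos ψ)] at this
      have h2 : (1 + ‖ψ.1.1‖)⁻¹ * ‖ψ.1.1‖ ≤ 1 := by
        rw [inv_mul_le_iff₀ (by positivity)]
        linarith
      have h3 : (1 / 2 : ℝ) ^ e ψ ≤ (1 / 2 : ℝ) ^ N :=
        pow_le_pow_of_le_one (by norm_num) (by norm_num) hlt
      have h4 : (1 / 2 : ℝ) ^ e ψ * ((1 + ‖ψ.1.1‖)⁻¹ * ‖ψ.1.1‖) ≤ (1 / 2 : ℝ) ^ e ψ * 1 := by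
        gcongr
      linarith)
  refine ⟨B, hB, fun z => ⟨fun hz => ?_, fun hz => ?_⟩⟩
  · by_contra hzY
    have h1 : (Y.mkQL : Z →L[𝕜] Z ⧸ Y) z ≠ 0 := fun h =>
      hzY ((Submodule.Quotient.mk_eq_zero Y).1 h)
    obtain ⟨f, hf⟩ := SeparatingDual.exists_ne_zero (R := 𝕜) h1
    let ψ : ι := ⟨f ∘L Y.mkQL, fun y hy => by
      have : (Y.mkQL : Z →L[𝕜] Z ⧸ Y) y = 0 := (Submodule.Quotient.mk_eq_zero Y).2 hy
      rw [ContinuousLinearMap.comp_apply, this, map_zero]⟩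
    have h2 : z ∈ ⋃ i ∈ T, {z : Z | (i : ι).1 z ≠ 0} := by
      rw [hTU]
      exact Set.mem_iUnion.2 ⟨ψ, hf⟩
    obtain ⟨χ, hχT, hχ⟩ := Set.mem_iUnion₂.1 h2
    have h3 := hBt ⟨χ, hχT⟩ z
    rw [hz, ContinuousMap.zero_apply, smul_apply, eq_comm, smul_eq_zero] at h3
    rcases h3 with h3 | h3
    · exact (hpos ⟨χ, hχT⟩).ne' (RCLike.ofReal_eq_zero.1 h3)
    · exact hχ h3
  · exact hB0 z fun ψ => by
      rw [smul_apply, ψ.1.2 z hz, smul_zero]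

/-- A compact set is contained in the closed absolutely convex hull of a null family. -/
theorem IsCompact.exists_null_family {V : Type*} [NormedAddCommGroup V] [NormedSpace 𝕜 V]
    {K : Set V} (hK : IsCompact K) :
    ∃ S : Set V, S.Countable ∧ (∀ δ : ℝ, 0 < δ → {s : S | δ ≤ ‖(s : V)‖}.Finite) ∧
      ∀ (T : V →L[𝕜] V) (ε : ℝ), (∀ s ∈ S, ‖T s‖ ≤ ε) → ∀ k ∈ K, ‖T k‖ ≤ ε := by
  choose F hFK hF hcov using fun j : ℕ =>
    hK.finite_cover_balls (e := (1 / 8 : ℝ) ^ j) (by positivity)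
  let D : ℕ → Set V := fun j =>
    {d | ∃ f ∈ F j, ∃ f' ∈ F (j + 1), dist f' f ≤ 2 * (1 / 8 : ℝ) ^ j ∧
      d = (2 : 𝕜) ^ (j + 2) • (f' - f)}
  let D₀ : Set V := (fun f => (2 : 𝕜) • f) '' F 0
  have hD₀ : D₀.Finite := (hF 0).image _
  have hD : ∀ j, (D j).Finite := fun j => by
    refine (((hF j).prod (hF (j + 1))).image
      fun p => (2 : 𝕜) ^ (j + 2) • (p.2 - p.1)).subset ?_
    rintro _ ⟨f, hf, f', hf', -, rfl⟩
    exact ⟨(f, f'), ⟨hf, hf'⟩, rfl⟩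
  have hDn : ∀ j, ∀ d ∈ D j, ‖d‖ ≤ 8 * (1 / 4 : ℝ) ^ j := by
    rintro j _ ⟨f, -, f', -, hd, rfl⟩
    rw [dist_eq_norm] at hd
    rw [norm_smul, norm_pow, RCLike.norm_ofNat]
    calc (2 : ℝ) ^ (j + 2) * ‖f' - f‖ ≤ 2 ^ (j + 2) * (2 * (1 / 8 : ℝ) ^ j) := by gcongr
      _ = 8 * (2 * (1 / 8 : ℝ)) ^ j := by rw [mul_pow]; ring
      _ = _ := by norm_num
  refine ⟨D₀ ∪ ⋃ j, D j, hD₀.countable.union (Set.countable_iUnion fun j => (hD j).countable),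
    fun δ hδ => ?_, fun T ε hT k hk => ?_⟩
  · obtain ⟨N, hN⟩ := exists_pow_lt_of_lt_one (by positivity : 0 < δ / 8)
      (by norm_num : (1 / 4 : ℝ) < 1)
    have hfin : (D₀ ∪ ⋃ j ∈ Set.Iio N, D j).Finite :=
      hD₀.union ((Set.finite_lt_nat N).biUnion fun j _ => hD j)
    refine (hfin.preimage Subtype.val_injective.injOn).subset ?_
    rintro ⟨s, hs | hs⟩ hδs
    · exact Or.inl hs
    · obtain ⟨j, hj⟩ := Set.mem_iUnion.1 hs
      refine Or.inr (Set.mem_iUnion₂.2 ⟨j, ?_, hj⟩)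
      by_contra hlt
      have hlt : N ≤ j := not_lt.1 hlt
      have h1 : δ ≤ ‖s‖ := hδs
      have h2 := hDn j s hj
      have h3 : (1 / 4 : ℝ) ^ j ≤ (1 / 4 : ℝ) ^ N :=
        pow_le_pow_of_le_one (by norm_num) (by norm_num) hlt
      linarith
  · have hex : ∀ j, ∃ f ∈ F j, dist k f < (1 / 8 : ℝ) ^ j := fun j => by
      obtain ⟨f, hf, hkf⟩ := Set.mem_iUnion₂.1 (hcov j hk)
      exact ⟨f, hf, hkf⟩
    choose f hf hkf using hex
    have hstep : ∀ j, ‖T (f (j + 1) - f j)‖ ≤ ε * (1 / 2 : ℝ) ^ (j + 2) := fun j => by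
      have hd : dist (f (j + 1)) (f j) ≤ 2 * (1 / 8 : ℝ) ^ j := by
        have h1 := dist_triangle_left (f (j + 1)) (f j) k
        have h2 := hkf j
        have h3 := hkf (j + 1)
        have h4 : (1 / 8 : ℝ) ^ (j + 1) ≤ (1 / 8 : ℝ) ^ j :=
          pow_le_pow_of_le_one (by norm_num) (by norm_num) j.le_succ
        linarith
      have h1 := hT _ (Or.inr (Set.mem_iUnion.2 ⟨j, f j, hf j, f (j + 1), hf _, hd, rfl⟩))
      rw [map_smul, norm_smul, norm_pow, RCLike.norm_ofNat, mul_comm, ← le_div_iff₀ (by positivity)]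
        at h1
      simpa [div_eq_mul_inv] using h1
    have hbd : ∀ n, ‖T (f n)‖ ≤ ε * (1 - (1 / 2 : ℝ) ^ (n + 1)) := fun n => by
      induction n with
      | zero =>
        have h1 := hT _ (Or.inl ⟨f 0, hf 0, rfl⟩)
        simp only [map_smul, norm_smul, RCLike.norm_ofNat] at h1
        norm_num
        linarith
      | succ n ih =>
        have h1 := norm_add_le (T (f n)) (T (f (n + 1) - f n))
        rw [← map_add, add_sub_cancel] at h1
        have h2 := hstep n
        rw [pow_succ] at h2 ⊢
        linarith
    have hε : 0 ≤ ε := (norm_nonneg _).trans (hT _ (Or.inl ⟨f 0, hf 0, rfl⟩))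
    have hlim : Filter.Tendsto f Filter.atTop (𝓝 k) := by
      rw [tendsto_iff_dist_tendsto_zero]
      refine squeeze_zero (fun _ => dist_nonneg) (fun j => ?_)
        (tendsto_pow_atTop_nhds_zero_of_lt_one (by norm_num : (0 : ℝ) ≤ 1 / 8) (by norm_num))
      rw [dist_comm]
      exact (hkf j).le
    refine le_of_tendsto ((T.continuous.tendsto k).comp hlim).norm
      (Filter.Eventually.of_forall fun n => (hbd n).trans ?_)
    have : 0 ≤ ε * (1 / 2 : ℝ) ^ (n + 1) := by positivity
    linarith

end Bumps

section DualApproximation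

variable {𝕜 : Type*} [RCLike 𝕜]

/-- An approximable operator into `Y` is nearly `S ∘ R` with `R` of finite rank, when `S` has dense
range in `Y`. -/
theorem exists_comp_near_of_denseRange {E F Y : Type*} [NormedAddCommGroup E] [NormedSpace 𝕜 E]
    [NormedAddCommGroup F] [NormedSpace 𝕜 F] [NormedAddCommGroup Y] [NormedSpace 𝕜 Y]
    {S : F →L[𝕜] Y} (hS : DenseRange S) {T : E →L[𝕜] Y}
    (hT : T ∈ approximableMaps 𝕜 E Y) {ε : ℝ} (hε : 0 < ε) :
    ∃ R ∈ finiteRankMaps 𝕜 E F, ‖T - S ∘L R‖ < ε := by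
  let Λ : (E →L[𝕜] F) →ₗ[𝕜] (E →L[𝕜] Y) := (ContinuousLinearMap.compL 𝕜 E F Y S).toLinearMap
  have h2 : approximableMaps 𝕜 E Y ≤ ((finiteRankMaps 𝕜 E F).map Λ).topologicalClosure := by
    refine approximableMaps_le (Submodule.isClosed_topologicalClosure _) fun φ y => ?_
    refine map_mem_closure (f := fun y : Y => φ.smulRight y)
      ((ContinuousLinearMap.smulRightL 𝕜 E Y) φ).continuous (hS y) ?_
    rintro _ ⟨x, rfl⟩
    exact ⟨φ.smulRight x, smulRight_mem_finiteRankMaps _ _,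
      ContinuousLinearMap.ext fun z => map_smul S (φ z) x⟩
  obtain ⟨_, ⟨R, hR, rfl⟩, hd⟩ := Metric.mem_closure_iff.1 (h2 hT) ε hε
  exact ⟨R, hR, by rwa [dist_eq_norm] at hd⟩

theorem hasApproximationProperty_dual_of_codRestrict {K : Type*} [TopologicalSpace K]
    [CompactSpace K] [T2Space K] [Infinite K] {E : Type*} [NormedAddCommGroup E] [NormedSpace 𝕜 E]
    (h : ∀ (Y : Submodule 𝕜 C(K, 𝕜)) (_ : IsClosed (Y : Set C(K, 𝕜))) (S : E →L[𝕜] C(K, 𝕜))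
      (_ : S ∈ approximableMaps 𝕜 E C(K, 𝕜)) (hS : ∀ x, S x ∈ Y),
      S.codRestrict Y hS ∈ approximableMaps 𝕜 E Y) :
    HasApproximationProperty 𝕜 (StrongDual 𝕜 E) := by
  intro Q hQ ε hε
  obtain ⟨Γ, hΓ, hΓ0, hΓQ⟩ := hQ.exists_null_family (𝕜 := 𝕜)
  have : Countable Γ := hΓ
  obtain ⟨S, hS, t, hSt, -⟩ := exists_approximableMaps_eval (K := K)
    (fun γ : Γ => (γ : StrongDual 𝕜 E)) hΓ0
  let Y := (LinearMap.range (S : E →ₗ[𝕜] C(K, 𝕜))).topologicalClosure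
  have hSY : ∀ x, S x ∈ Y := fun x => Submodule.le_topologicalClosure _ ⟨x, rfl⟩
  have hdense : DenseRange (S.codRestrict Y hSY) := fun y => by
    rw [closure_subtype]
    have : Subtype.val '' Set.range (S.codRestrict Y hSY) =
        (LinearMap.range (S : E →ₗ[𝕜] C(K, 𝕜)) : Set _) := by
      rw [← Set.range_comp]
      rfl
    rw [this]
    exact y.2
  obtain ⟨R, hR, hd⟩ := exists_comp_near_of_denseRange hdense
    (h Y (Submodule.isClosed_topologicalClosure _) S hS hSY) hε
  have h3 : ∀ x, ‖S x - S (R x)‖ ≤ ε * ‖x‖ := fun x =>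
    (S.codRestrict Y hSY - S.codRestrict Y hSY ∘L R).le_of_opNorm_le hd.le x
  refine ⟨adjointMap 𝕜 E E R, adjointMap_mem_finiteRankMaps hR,
    hΓQ (adjointMap 𝕜 E E R - ContinuousLinearMap.id 𝕜 (StrongDual 𝕜 E)) ε fun γ hγ => ?_⟩
  rw [sub_apply, adjointMap_apply, ContinuousLinearMap.id_apply]
  refine ContinuousLinearMap.opNorm_le_bound _ hε.le fun x => ?_
  have h4 : ‖(S x - S (R x)) (t ⟨γ, hγ⟩)‖ ≤ ε * ‖x‖ :=
    (ContinuousMap.norm_coe_le_norm _ _).trans (h3 x)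
  rw [ContinuousMap.sub_apply, hSt, hSt, norm_sub_rev] at h4
  exact h4

/-- If the algebra of approximable operators on a space with complemented subspaces `E` and `C(K)`
is left flat, then the dual of `E` has the approximation property. -/
theorem hasApproximationProperty_dual_of_isLeftFlat {K : Type*} [TopologicalSpace K]
    [CompactSpace K] [T2Space K] [Infinite K] [SecondCountableTopology C(K, 𝕜)]
    {E : Type*} [NormedAddCommGroup E]
    [NormedSpace 𝕜 E] {X : Type*} [NormedAddCommGroup X] [NormedSpace 𝕜 X]
    (iE : E →L[𝕜] X) (pE : X →L[𝕜] E) (hE : ∀ x, pE (iE x) = x)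
    (iC : C(K, 𝕜) →L[𝕜] X) (pC : X →L[𝕜] C(K, 𝕜)) (hC : ∀ x, pC (iC x) = x)
    (h : IsLeftFlat 𝕜 (approximableOperators 𝕜 X)) :
    HasApproximationProperty 𝕜 (StrongDual 𝕜 E) := by
  refine hasApproximationProperty_dual_of_codRestrict (K := K) fun Y hY S hS hSY => ?_
  obtain ⟨B, hB, hBY⟩ := exists_approximableMaps_ker_eq K Y hY
  let a : approximableOperators 𝕜 X :=
    ⟨iC ∘L S ∘L pE, comp_mem_approximableMaps _ (approximableMaps_comp hS _)⟩
  let r : approximableOperators 𝕜 X :=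
    ⟨iC ∘L B ∘L pC, comp_mem_approximableMaps _ (approximableMaps_comp hB _)⟩
  have hra : r * a = 0 := by
    refine Subtype.ext (ContinuousLinearMap.ext fun x => ?_)
    change iC (B (pC (iC (S (pE x))))) = 0
    rw [hC, (hBY _).2 (hSY _), map_zero]
  let A := approximableOperators 𝕜 X
  have key : ∀ x ∈ Submodule.span 𝕜 {x : X →L[𝕜] X | ∃ (m : X →L[𝕜] X) (b : A),
        (r : X →L[𝕜] X) * m = 0 ∧ x = m * b},
      ∃ U ∈ approximableMaps 𝕜 E Y, Y.subtypeL ∘L U = pC ∘L x ∘L iE := by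
    intro x hx
    refine Submodule.span_induction ?_ ?_ ?_ ?_ hx
    · rintro _ ⟨m, b, hm, rfl⟩
      have h1 : ∀ x, pC (m x) ∈ Y := fun x => by
        have h2 : iC (B (pC (m x))) = 0 := DFunLike.congr_fun hm x
        rw [← hBY, ← hC (B _), h2, map_zero]
      exact ⟨(pC ∘L m).codRestrict Y h1 ∘L (b : X →L[𝕜] X) ∘L iE,
        comp_mem_approximableMaps _ (approximableMaps_comp b.2 _), rfl⟩
    · exact ⟨0, Submodule.zero_mem _, by simp⟩
    · rintro x y - - ⟨U, hU, hUx⟩ ⟨V, hV, hVy⟩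
      refine ⟨U + V, Submodule.add_mem _ hU hV, ?_⟩
      simp only [ContinuousLinearMap.comp_add, ContinuousLinearMap.add_comp, hUx, hVy]
    · rintro c x - ⟨U, hU, hUx⟩
      refine ⟨c • U, Submodule.smul_mem _ _ hU, ?_⟩
      simp only [ContinuousLinearMap.comp_smul, ContinuousLinearMap.smul_comp, hUx]
  obtain ⟨U, hU, hUS⟩ := key _ (h.mem_span_of_mul_eq_zero_subalgebra hra)
  have hUS' : S.codRestrict Y hSY = U := by
    refine ContinuousLinearMap.ext fun x => Subtype.ext ?_
    refine Eq.trans ?_ (DFunLike.congr_fun hUS x).symm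
    change S x = pC (iC (S (pE (iE x))))
    rw [hC, hE]
  rw [hUS']
  exact hU

end DualApproximation

/-! ### Approximable corestrictions from the approximation property of the dual -/

section DualToCorestriction

variable {𝕜 : Type*} [RCLike 𝕜] {X Y Z : Type*} [NormedAddCommGroup X] [NormedSpace 𝕜 X]
  [NormedAddCommGroup Y] [NormedSpace 𝕜 Y] [NormedAddCommGroup Z] [NormedSpace 𝕜 Z]

theorem isCompactOperator_of_mem_approximableMaps [CompleteSpace Y] {T : X →L[𝕜] Y}
    (hT : T ∈ approximableMaps 𝕜 X Y) : IsCompactOperator T := by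
  refine approximableMaps_le (N := compactOperator (RingHom.id 𝕜) X Y)
    isClosed_setOfPred_isCompactOperator (fun φ y => ?_) hT
  have h : IsCompactOperator (φ : X → 𝕜) := isCompactOperator_of_locallyCompactSpace_dom φ
  exact h.clm_comp (ContinuousLinearMap.toSpanSingleton 𝕜 y)

/-- The second adjoint of an approximable operator into a Banach space takes values in that
space. -/
theorem exists_eval_eq_of_mem_approximableMaps [CompleteSpace Z] {T : X →L[𝕜] Z}
    (hT : T ∈ approximableMaps 𝕜 X Z) (φ : StrongDual 𝕜 (StrongDual 𝕜 X)) :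
    ∃ z : Z, ∀ f : StrongDual 𝕜 Z, f z = φ (f ∘L T) := by
  let J := NormedSpace.inclusionInDoubleDualLi 𝕜 (E := Z)
  let Λ : (X →L[𝕜] Z) →L[𝕜] StrongDual 𝕜 (StrongDual 𝕜 Z) :=
    (ContinuousLinearMap.compL 𝕜 (StrongDual 𝕜 Z) (StrongDual 𝕜 X) 𝕜 φ) ∘L adjointMap 𝕜 X Z
  have hΛ : ∀ T f, Λ T f = φ (f ∘L T) := fun _ _ => rfl
  have hcl : IsClosed ((LinearMap.range J.toLinearMap).comap Λ.toLinearMap : Set (X →L[𝕜] Z)) := by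
    have h1 := J.isometry.isUniformInducing.isComplete_range.isClosed
    exact h1.preimage Λ.continuous
  obtain ⟨z, hz⟩ := approximableMaps_le hcl (fun ψ z => ⟨φ ψ • z, by
    ext f
    refine Eq.trans (map_smul f (φ ψ) z) ?_
    rw [ContinuousLinearMap.coe_coe, hΛ]
    have : f ∘L ψ.smulRight z = f z • ψ := by
      ext x
      simp [mul_comm]
    rw [this, map_smul, smul_eq_mul, smul_eq_mul, mul_comm]⟩) hT
  exact ⟨z, fun f => (DFunLike.congr_fun hz f).trans (hΛ T f)⟩

theorem exists_dual_eq_zero_of_notMem {Y : Submodule 𝕜 Z} (hY : IsClosed (Y : Set Z)) {z : Z}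
    (hz : z ∉ Y) : ∃ f : StrongDual 𝕜 Z, (∀ y ∈ Y, f y = 0) ∧ f z ≠ 0 := by
  have h1 : (Y.mkQL : Z →L[𝕜] Z ⧸ Y) z ≠ 0 := fun h => hz ((Submodule.Quotient.mk_eq_zero Y).1 h)
  obtain ⟨f, hf⟩ := SeparatingDual.exists_ne_zero (R := 𝕜) h1
  refine ⟨f ∘L Y.mkQL, fun y hy => ?_, hf⟩
  have : (Y.mkQL : Z →L[𝕜] Z ⧸ Y) y = 0 := (Submodule.Quotient.mk_eq_zero Y).2 hy
  rw [ContinuousLinearMap.comp_apply, this, map_zero]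

/-- If the dual of `X` has the approximation property, approximable operators on `X` with values
in a closed subspace are approximable as operators into that subspace. -/
theorem HasApproximationProperty.hasApproximableCorestriction
    (h : HasApproximationProperty 𝕜 (StrongDual 𝕜 X)) :
    HasApproximableCorestriction.{w} 𝕜 X := by
  intro Z _ _ _ Y hY T hT hTY
  have hcl := isClosed_approximableMaps (𝕜 := 𝕜) (X := X) (Y := Y)
  rw [← SetLike.mem_coe, ← hcl.closure_eq, Metric.mem_closure_iff]
  intro ε hε
  have hQ : IsCompact (closure (adjointMap 𝕜 X Z T '' Metric.closedBall 0 1)) :=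
    (isCompactOperator_of_mem_approximableMaps
      (adjointMap_mem_approximableMaps hT)).isCompact_closure_image_closedBall
        (f := (adjointMap 𝕜 X Z T).toLinearMap) 1
  obtain ⟨R, hR, hRQ⟩ := h _ hQ (ε / 2) (by positivity)
  let N : Submodule 𝕜 (StrongDual 𝕜 X →L[𝕜] StrongDual 𝕜 X) :=
    { carrier := {R | ∃ U ∈ approximableMaps 𝕜 X Y, ∀ (f : StrongDual 𝕜 Z) (x : X),
        f (U x : Z) = R (f ∘L T) x}
      zero_mem' := ⟨0, Submodule.zero_mem _, fun f x => by simp⟩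
      add_mem' := by
        rintro R R' ⟨U, hU, hUR⟩ ⟨U', hU', hUR'⟩
        exact ⟨U + U', Submodule.add_mem _ hU hU', fun f x => by simp [hUR, hUR']⟩
      smul_mem' := by
        rintro c R ⟨U, hU, hUR⟩
        exact ⟨c • U, Submodule.smul_mem _ _ hU, fun f x => by simp [hUR]⟩ }
  obtain ⟨U, hU, hUR⟩ := finiteRankMaps_le (N := N) (fun φ g => by
    obtain ⟨z, hz⟩ := exists_eval_eq_of_mem_approximableMaps hT φ
    have hzY : z ∈ Y := by
      by_contra hzY
      obtain ⟨f, hfY, hfz⟩ := exists_dual_eq_zero_of_notMem hY hzY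
      have : f ∘L T = 0 := by
        ext x
        exact hfY _ (hTY x)
      exact hfz (by rw [hz, this, map_zero])
    refine ⟨g.smulRight (⟨z, hzY⟩ : Y),
      finiteRankMaps_le_approximableMaps (smulRight_mem_finiteRankMaps _ _), fun f x => ?_⟩
    simp [hz, mul_comm]) hR
  refine ⟨U, hU, lt_of_le_of_lt ?_ (half_lt_self hε)⟩
  rw [dist_eq_norm]
  refine ContinuousLinearMap.opNorm_le_bound _ (by positivity) fun x => ?_
  refine NormedSpace.norm_le_dual_bound 𝕜 (T x - U x) (by positivity) fun f => ?_
  rcases eq_or_ne f 0 with rfl | hf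
  · simp
  have hf' : (‖f‖ : 𝕜) ≠ 0 := by simpa using hf
  have hf0 : 0 < ‖f‖ := norm_pos_iff.2 hf
  set g : StrongDual 𝕜 Z := (‖f‖ : 𝕜)⁻¹ • f with hg
  have hgn : ‖g‖ ≤ 1 := by
    rw [hg, norm_smul, norm_inv, RCLike.norm_ofReal, abs_of_pos hf0, inv_mul_cancel₀ hf0.ne']
  have hfg : f = (‖f‖ : 𝕜) • g := by rw [hg, smul_smul, mul_inv_cancel₀ hf', one_smul]
  have h1 := hRQ (adjointMap 𝕜 X Z T g) (subset_closure ⟨g, by simpa using hgn, rfl⟩)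
  have h2 : ‖g (T x - U x)‖ ≤ ε / 2 * ‖x‖ := by
    rw [map_sub, hUR, norm_sub_rev]
    exact (R (adjointMap 𝕜 X Z T g) - adjointMap 𝕜 X Z T g).le_of_opNorm_le h1 x
  calc ‖f (T x - U x)‖ = ‖f‖ * ‖g (T x - U x)‖ := by
        conv_lhs => rw [hfg]
        rw [smul_apply, norm_smul, RCLike.norm_ofReal, abs_of_pos hf0]
    _ ≤ ‖f‖ * (ε / 2 * ‖x‖) := by gcongr
    _ = ε / 2 * ‖x‖ * ‖f‖ := by ring

end DualToCorestriction

/-! ### Sums of finite dimensional spaces -/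

section ShrinkingDecompositions

variable {𝕜 : Type*} [RCLike 𝕜]

/-- Partial sum projections are shrinking when disjoint blocks satisfy an upper estimate. -/
theorem tendsto_dual_comp_of_blocks {C : Type*} [NormedAddCommGroup C] [NormedSpace 𝕜 C]
    {P : ℕ → C →L[𝕜] C} (hPP : ∀ {m n}, m ≤ n → ∀ x, P m (P n x) = P m x)
    (hlim : ∀ x, Filter.Tendsto (fun n => P n x) Filter.atTop (𝓝 x))
    (hQ : ∀ n x, ‖x - P n x‖ ≤ ‖x‖) {c : ℝ} (hc : c < 2)
    (hblock : ∀ n x y, ‖x‖ ≤ 1 → ‖y‖ ≤ 1 → ‖P n x + (y - P n y)‖ ≤ c) (f : StrongDual 𝕜 C) :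
    Filter.Tendsto (fun n => f ∘L P n) Filter.atTop (𝓝 f) := by
  let a : ℕ → ℝ := fun n => ‖f - f ∘L P n‖
  have hle : ∀ n x, ‖f x - f (P n x)‖ ≤ a n * ‖x‖ := fun n x => (f - f ∘L P n).le_opNorm x
  have hanti : Antitone a := by
    intro n m hnm
    refine ContinuousLinearMap.opNorm_le_bound _ (norm_nonneg _) fun x => ?_
    have h1 := hle n (x - P m x)
    rw [map_sub (P n), hPP hnm, sub_self, map_zero, sub_zero, map_sub] at h1
    exact h1.trans (mul_le_mul_of_nonneg_left (hQ m x) (norm_nonneg _))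
  have hlimA := tendsto_atTop_ciInf hanti ⟨0, by rintro _ ⟨n, rfl⟩; exact norm_nonneg _⟩
  set A := ⨅ n, a n
  have hAle : ∀ n, A ≤ a n := hanti.le_of_tendsto hlimA
  have hA0 : 0 ≤ A := ge_of_tendsto' hlimA fun n => norm_nonneg _
  have key : ∀ n, ∀ δ > 0, A ≤ (c - 1) * a n + 2 * δ := by
    intro n δ hδ
    obtain ⟨x, hx, hfx⟩ := (f - f ∘L P n).exists_lt_apply_of_lt_opNorm (sub_lt_self _ hδ)
    set x' := x - P n x
    have hx' : ‖x'‖ ≤ 1 := (hQ n x).trans hx.le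
    have hfx' : a n - δ < ‖f x'‖ := by
      have : (f - f ∘L P n) x = f x' := by simp [x']
      rwa [this] at hfx
    have hev := (((f.continuous.tendsto x').comp (hlim x')).norm.eventually_const_lt hfx').and
      (Filter.eventually_ge_atTop n)
    obtain ⟨m, hm, hnm⟩ := hev.exists
    have hm : a n - δ < ‖f (P m x')‖ := hm
    obtain ⟨y, hy, hfy⟩ := (f - f ∘L P m).exists_lt_apply_of_lt_opNorm (sub_lt_self _ hδ)
    have hfy : a m - δ < ‖f (y - P m y)‖ := by
      have : (f - f ∘L P m) y = f (y - P m y) := by simp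
      rwa [this] at hfy
    obtain ⟨α, hα, hαx⟩ := RCLike.exists_norm_eq_mul_self (f (P m x'))
    obtain ⟨β, hβ, hβy⟩ := RCLike.exists_norm_eq_mul_self (f (y - P m y))
    have hw := hblock m (α • x') (β • y) (by rwa [norm_smul, hα, one_mul])
      (by rw [norm_smul, hβ, one_mul]; exact hy.le)
    set w := P m (α • x') + (β • y - P m (β • y)) with hw_def
    have hfw : f w = ((‖f (P m x')‖ + ‖f (y - P m y)‖ : ℝ) : 𝕜) := by
      have : w = α • P m x' + β • (y - P m y) := by simp [hw_def, smul_sub]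
      rw [this, map_add, map_smul, map_smul, smul_eq_mul, smul_eq_mul, ← hαx, ← hβy,
        RCLike.ofReal_add]
    have hPw : P n w = 0 := by
      simp only [hw_def, map_add, map_sub, map_smul, hPP hnm, sub_self, smul_zero, add_zero, x',
        hPP le_rfl]
    have h1 := hle n w
    rw [hPw, map_zero, sub_zero, hfw, RCLike.norm_ofReal, abs_of_nonneg (by positivity)] at h1
    have h2 : a n * ‖w‖ ≤ a n * c := mul_le_mul_of_nonneg_left hw (norm_nonneg _)
    have h3 := hAle m
    linarith
  have key' : ∀ n, A ≤ (c - 1) * a n := fun n =>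
    le_of_forall_pos_le_add fun δ hδ => by
      have := key n (δ / 2) (by positivity)
      linarith
  have hA : A ≤ (c - 1) * A := ge_of_tendsto' (hlimA.const_mul _) key'
  have hA' : A = 0 := by nlinarith
  rw [tendsto_iff_norm_sub_tendsto_zero]
  rw [hA'] at hlimA
  refine hlimA.congr fun n => norm_sub_rev _ _

variable {G : ℕ → Type*} [∀ i, NormedAddCommGroup (G i)] [∀ i, NormedSpace 𝕜 (G i)]
  {C : Type*} [NormedAddCommGroup C] [NormedSpace 𝕜 C]

/-- The partial sum projections. -/
noncomputable def CoordinateSystem.partialSum (s : CoordinateSystem 𝕜 G C) (n : ℕ) : C →L[𝕜] C :=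
  ∑ i ∈ Finset.range n, s.ι i ∘L s.π i

theorem CoordinateSystem.partialSum_apply (s : CoordinateSystem 𝕜 G C) (n : ℕ) (x : C) :
    s.partialSum n x = ∑ i ∈ Finset.range n, s.ι i (s.π i x) := by
  simp [partialSum, sum_apply]

theorem CoordinateSystem.π_partialSum (s : CoordinateSystem 𝕜 G C) (n i : ℕ) (x : C) :
    s.π i (s.partialSum n x) = if i < n then s.π i x else 0 := by
  rw [partialSum_apply, map_sum]
  split_ifs with h
  · rw [Finset.sum_eq_single_of_mem i (Finset.mem_range.2 h) fun j _ hj => s.π_ι_ne _ _ _ hj,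
      s.π_ι_same]
  · exact Finset.sum_eq_zero fun j hj => s.π_ι_ne _ _ _ (by
      rintro rfl
      exact h (Finset.mem_range.1 hj))

theorem CoordinateSystem.hasApproximableCorestriction (s : CoordinateSystem 𝕜 G C)
    [∀ i, FiniteDimensional 𝕜 (G i)]
    (hlim : ∀ x, Filter.Tendsto (fun n => s.partialSum n x) Filter.atTop (𝓝 x))
    (hP : ∀ n x, ‖s.partialSum n x‖ ≤ ‖x‖)
    (hQ : ∀ n x, ‖x - s.partialSum n x‖ ≤ ‖x‖) {c : ℝ} (hc : c < 2)
    (hblock : ∀ n x y, ‖x‖ ≤ 1 → ‖y‖ ≤ 1 → ‖s.partialSum n x + (y - s.partialSum n y)‖ ≤ c) :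
    HasApproximableCorestriction.{w} 𝕜 C := by
  refine hasApproximableCorestriction_of_tendsto (l := Filter.atTop) (R := s.partialSum)
    (fun n => Submodule.sum_mem _ fun i _ => finiteRankMaps_le_approximableMaps
      (finiteRankMaps_comp (mem_finiteRankMaps_of_domain _) _)) zero_le_one
    (fun n => ContinuousLinearMap.opNorm_le_bound _ zero_le_one fun x => by
      rw [one_mul]; exact hP n x)
    (tendsto_dual_comp_of_blocks (fun {m n} hmn x => ?_) hlim hQ hc hblock)
  rw [s.partialSum_apply m, s.partialSum_apply m]
  refine Finset.sum_congr rfl fun i hi => ?_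
  rw [s.π_partialSum, if_pos ((Finset.mem_range.1 hi).trans_le hmn)]

theorem hasApproximableCorestriction_lp [∀ i, FiniteDimensional 𝕜 (G i)] (p : ℝ≥0∞)
    [Fact (1 ≤ p)] (hp : 1 < p) (hp' : p < ∞) :
    HasApproximableCorestriction.{w} 𝕜 (lp G p) := by
  let s : CoordinateSystem 𝕜 G (lp G p) := lpCoordinates p
  have hp0 : p ≠ 0 := (zero_lt_one.trans hp).ne'
  have hpr : 1 < p.toReal := by
    rw [← ENNReal.toReal_one]
    exact (ENNReal.toReal_lt_toReal ENNReal.one_ne_top hp'.ne).2 hp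
  have hpr0 : 0 < p.toReal := zero_lt_one.trans hpr
  have hs : ∀ n i (x : lp G p), (s.partialSum n x : lp G p) i = if i < n then x i else 0 :=
    s.π_partialSum
  have hs' : ∀ n i (x : lp G p), (x - s.partialSum n x : lp G p) i = if i < n then 0 else x i := by
    intro n i x
    rw [lp.coeFn_sub, Pi.sub_apply, hs]
    split_ifs <;> simp
  refine s.hasApproximableCorestriction (c := 2 ^ p.toReal⁻¹) (fun x => ?_)
    (fun n x => lp.norm_mono hp0 fun i => ?_) (fun n x => lp.norm_mono hp0 fun i => ?_) ?_
    (fun n x y hx hy => lp.norm_le_of_forall_sum_le hpr0 (by positivity) fun t => ?_)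
  · simp only [s.partialSum_apply]
    exact (lp.hasSum_single hp'.ne x).tendsto_sum_nat
  · rw [hs]
    split_ifs <;> simp
  · rw [hs']
    split_ifs <;> simp
  · calc (2 : ℝ) ^ p.toReal⁻¹ < 2 ^ (1 : ℝ) :=
          Real.rpow_lt_rpow_of_exponent_lt one_lt_two (inv_lt_one_of_one_lt₀ hpr)
      _ = 2 := Real.rpow_one 2
  · rw [← Real.rpow_mul zero_le_two, inv_mul_cancel₀ hpr0.ne', Real.rpow_one]
    have h1 := lp.sum_rpow_le_norm_rpow hpr0 x t
    have h2 := lp.sum_rpow_le_norm_rpow hpr0 y t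
    have h3 : ‖x‖ ^ p.toReal ≤ 1 := Real.rpow_le_one (norm_nonneg _) hx hpr0.le
    have h4 : ‖y‖ ^ p.toReal ≤ 1 := Real.rpow_le_one (norm_nonneg _) hy hpr0.le
    have h5 : ∑ i ∈ t, ‖(s.partialSum n x + (y - s.partialSum n y) : lp G p) i‖ ^ p.toReal ≤
        ∑ i ∈ t, (‖x i‖ ^ p.toReal + ‖y i‖ ^ p.toReal) := by
      refine Finset.sum_le_sum fun i _ => ?_
      rw [lp.coeFn_add, Pi.add_apply, hs, hs']
      split_ifs
      · rw [add_zero]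
        exact le_add_of_nonneg_right (by positivity)
      · rw [zero_add]
        exact le_add_of_nonneg_left (by positivity)
    rw [Finset.sum_add_distrib] at h5
    linarith

theorem hasApproximableCorestriction_c0Sum [∀ i, FiniteDimensional 𝕜 (G i)] :
    HasApproximableCorestriction.{w} 𝕜 (c0Sum 𝕜 G) := by
  let s : CoordinateSystem 𝕜 G (c0Sum 𝕜 G) := c0Coordinates
  have hs : ∀ n i (x : c0Sum 𝕜 G), (s.partialSum n x : lp G ∞) i = if i < n then x.1 i else 0 :=
    s.π_partialSum
  have hs' : ∀ n i (x : c0Sum 𝕜 G), (x - s.partialSum n x : c0Sum 𝕜 G).1 i =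
      if i < n then 0 else x.1 i := by
    intro n i x
    rw [Submodule.coe_sub, lp.coeFn_sub, Pi.sub_apply, hs]
    split_ifs <;> simp
  refine s.hasApproximableCorestriction (c := 1) (fun x => ?_)
    (fun n x => lp.norm_mono ENNReal.top_ne_zero (x := (s.partialSum n x).1) (y := x.1)
      fun i => ?_)
    (fun n x => lp.norm_mono ENNReal.top_ne_zero (x := (x - s.partialSum n x).1) (y := x.1)
      fun i => ?_) one_lt_two
    (fun n x y hx hy => lp.norm_le_of_forall_le (f := (s.partialSum n x +
      (y - s.partialSum n y)).1) zero_le_one fun i => ?_)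
  · rw [Metric.tendsto_atTop]
    intro ε hε
    have hx : Filter.Tendsto (fun i => ‖x.1 i‖) Filter.atTop (𝓝 0) := x.2
    obtain ⟨N, hN⟩ := Metric.tendsto_atTop.1 hx (ε / 2) (by positivity)
    refine ⟨N, fun n hn => lt_of_le_of_lt ?_ (half_lt_self hε)⟩
    rw [dist_comm, dist_eq_norm]
    refine lp.norm_le_of_forall_le (f := (x - s.partialSum n x).1) (by positivity) fun i => ?_
    rw [hs']
    split_ifs with h
    · rw [norm_zero]
      positivity
    · have := hN i (hn.trans (not_lt.1 h))
      rw [dist_zero_right, norm_norm] at this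
      exact this.le
  · rw [hs]
    split_ifs <;> simp
  · rw [hs']
    split_ifs <;> simp
  · rw [Submodule.coe_add, lp.coeFn_add, Pi.add_apply, hs, hs']
    split_ifs
    · rw [add_zero]
      exact (lp.norm_apply_le_norm ENNReal.top_ne_zero x.1 i).trans hx
    · rw [zero_add]
      exact (lp.norm_apply_le_norm ENNReal.top_ne_zero y.1 i).trans hy

end ShrinkingDecompositions

/-! ### Spaces of continuous functions -/

section ContinuousFunctions

variable {𝕜 : Type*} [RCLike 𝕜] {K : Type*} [TopologicalSpace K] [CompactSpace K]

/-- A bounded functional on `C(K)` is dominated by a positive functional. -/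
theorem exists_linearMap_norm_le (φ : StrongDual 𝕜 C(K, 𝕜)) :
    ∃ Λ : C(K, ℝ) →ₗ[ℝ] ℝ, ∀ (h : C(K, 𝕜)) (v : C(K, ℝ)), (∀ x, ‖h x‖ ≤ v x) → ‖φ h‖ ≤ Λ v := by
  let D : C(K, ℝ) → Set ℝ := fun u => {r | ∃ (v : C(K, ℝ)) (h : C(K, 𝕜)), (∀ x, ‖h x‖ ≤ v x) ∧
    r = ‖φ‖ * ‖u + v‖ - RCLike.re (φ h)}
  have hne : ∀ u, (D u).Nonempty := fun u => ⟨_, 0, 0, fun x => by simp, rfl⟩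
  have hbd : ∀ u, ∀ r ∈ D u, -(‖φ‖ * ‖u‖) ≤ r := by
    rintro u _ ⟨v, h, hv, rfl⟩
    have h1 : ‖h‖ ≤ ‖v‖ := (ContinuousMap.norm_le _ (norm_nonneg _)).2 fun x =>
      (hv x).trans ((le_abs_self _).trans (v.norm_coe_le_norm x))
    have h2 : RCLike.re (φ h) ≤ ‖φ‖ * ‖v‖ := (RCLike.re_le_norm _).trans
      ((φ.le_opNorm h).trans (mul_le_mul_of_nonneg_left h1 (norm_nonneg _)))
    have h3 : ‖v‖ - ‖u‖ ≤ ‖u + v‖ := by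
      have := norm_sub_le (u + v) u
      rw [add_sub_cancel_left] at this
      linarith
    have h4 := mul_le_mul_of_nonneg_left h3 (norm_nonneg φ)
    linarith
  have hbb : ∀ u, BddBelow (D u) := fun u => ⟨_, fun r hr => hbd u r hr⟩
  let N : C(K, ℝ) → ℝ := fun u => sInf (D u)
  have hsmul_le : ∀ c : ℝ, 0 < c → ∀ u, N (c • u) ≤ c * N u := by
    intro c hc u
    rw [← inv_mul_le_iff₀ hc]
    refine le_csInf (hne u) ?_
    rintro _ ⟨v, h, hv, rfl⟩
    rw [inv_mul_le_iff₀ hc]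
    refine csInf_le (hbb _) ⟨c • v, (c : 𝕜) • h, fun x => ?_, ?_⟩
    · change ‖(c : 𝕜) * h x‖ ≤ c * v x
      rw [norm_mul, RCLike.norm_ofReal, abs_of_pos hc]
      exact mul_le_mul_of_nonneg_left (hv x) hc.le
    · rw [← smul_add, norm_smul, Real.norm_of_nonneg hc.le, map_smul, smul_eq_mul,
        RCLike.re_ofReal_mul]
      ring
  have hsmul : ∀ c : ℝ, 0 < c → ∀ u, N (c • u) = c * N u := by
    intro c hc u
    refine le_antisymm (hsmul_le c hc u) ?_
    have := hsmul_le c⁻¹ (inv_pos.2 hc) (c • u)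
    rw [smul_smul, inv_mul_cancel₀ hc.ne', one_smul] at this
    rwa [← le_inv_mul_iff₀ hc]
  have hadd : ∀ u u', N (u + u') ≤ N u + N u' := by
    intro u u'
    rw [← sub_le_iff_le_add]
    refine le_csInf (hne u) ?_
    rintro _ ⟨v, h, hv, rfl⟩
    rw [sub_le_comm]
    refine le_csInf (hne u') ?_
    rintro _ ⟨v', h', hv', rfl⟩
    rw [sub_le_iff_le_add]
    refine (csInf_le (hbb _) ⟨v + v', h + h', fun x => ?_, rfl⟩).trans ?_
    · exact (norm_add_le _ _).trans (add_le_add (hv x) (hv' x))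
    · have h1 : ‖u + u' + (v + v')‖ ≤ ‖u + v‖ + ‖u' + v'‖ := by
        rw [add_add_add_comm]
        exact norm_add_le _ _
      have h2 := mul_le_mul_of_nonneg_left h1 (norm_nonneg φ)
      rw [map_add, map_add]
      linarith
  obtain ⟨Λ, -, hΛ⟩ := exists_extension_of_le_sublinear (⊥ : C(K, ℝ) →ₗ.[ℝ] ℝ) N hsmul hadd (by
    rintro ⟨x, hx⟩
    obtain rfl : x = 0 := (Submodule.mem_bot ℝ).1 hx
    have : (⊥ : C(K, ℝ) →ₗ.[ℝ] ℝ) ⟨0, hx⟩ = 0 := LinearPMap.map_zero _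
    rw [this]
    refine le_csInf (hne 0) fun r hr => ?_
    simpa using hbd 0 r hr)
  have hre : ∀ (h : C(K, 𝕜)) (v : C(K, ℝ)), (∀ x, ‖h x‖ ≤ v x) → RCLike.re (φ h) ≤ Λ v := by
    intro h v hv
    have h1 := (hΛ (-v)).trans (csInf_le (hbb _) ⟨v, h, hv, rfl⟩)
    rw [map_neg, neg_add_cancel, norm_zero, mul_zero, zero_sub] at h1
    linarith
  refine ⟨Λ, fun h v hv => ?_⟩
  obtain ⟨c, hc, hch⟩ := RCLike.exists_norm_eq_mul_self (φ h)
  have h1 := hre (c • h) v fun x => by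
    rw [ContinuousMap.smul_apply, norm_smul, hc, one_mul]
    exact hv x
  rwa [map_smul, smul_eq_mul, ← hch, RCLike.ofReal_re] at h1

/-- A partition of unity on whose pieces finitely many functions are nearly constant. -/
theorem exists_partition_near [T2Space K] (F : Finset C(K, 𝕜)) {δ : ℝ} (hδ : 0 < δ) :
    ∃ (s : Finset K) (h : s → C(K, ℝ)), (∀ j x, 0 ≤ h j x) ∧ (∀ x, ∑ j, h j x = 1) ∧
      ∀ d ∈ F, ∀ j x, h j x ≠ 0 → ‖d x - d j‖ ≤ δ := by
  let U : K → Set K := fun t => {x | ∀ d ∈ F, ‖d x - d t‖ < δ}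
  have hU : ∀ t, IsOpen (U t) := fun t => by
    have : U t = ⋂ d ∈ F, {x | ‖d x - d t‖ < δ} := by ext; simp [U]
    rw [this]
    exact isOpen_biInter_finset fun d _ => isOpen_lt (by fun_prop) continuous_const
  obtain ⟨s, hs⟩ := isCompact_univ.elim_finite_subcover U hU fun x _ =>
    Set.mem_iUnion.2 ⟨x, fun d _ => by simpa using hδ⟩
  obtain ⟨f, hf⟩ := PartitionOfUnity.exists_isSubordinate isClosed_univ (fun j : s => U j)
    (fun j => hU j) (fun x hx => by
      obtain ⟨t, ht, hxt⟩ := Set.mem_iUnion₂.1 (hs hx)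
      exact Set.mem_iUnion.2 ⟨⟨t, ht⟩, hxt⟩)
  refine ⟨s, fun j => f j, fun j x => f.nonneg j x, fun x => ?_, fun d hd j x hx => ?_⟩
  · rw [← f.sum_eq_one (Set.mem_univ x), finsum_eq_sum_of_fintype]
  · exact (hf j (subset_tsupport _ hx) d hd).le

variable [T2Space K] [MeasurableSpace K] [BorelSpace K]

open MeasureTheory

theorem integrable_of_continuous {K : Type*} [TopologicalSpace K] [CompactSpace K]
    [MeasurableSpace K] [BorelSpace K] {ν : Measure K} [IsFiniteMeasure ν] {V : Type*}
    [NormedAddCommGroup V] {g : K → V} (hg : Continuous g) : Integrable g ν :=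
  hg.integrable_of_hasCompactSupport (HasCompactSupport.of_compactSpace _)

/-- Finitely many functionals on `C(K)` are dominated by a finite measure. -/
theorem exists_measure_norm_le (F : Finset (StrongDual 𝕜 C(K, 𝕜))) :
    ∃ ν : Measure K, IsFiniteMeasure ν ∧ ν.WeaklyRegular ∧
      ∀ φ ∈ F, ∀ h : C(K, 𝕜), ‖φ h‖ ≤ ∫ x, ‖h x‖ ∂ν := by
  choose Λ hΛ using fun φ : StrongDual 𝕜 C(K, 𝕜) => exists_linearMap_norm_le φ
  have hpos : ∀ φ, ∀ v : C(K, ℝ), (∀ x, 0 ≤ v x) → 0 ≤ Λ φ v := fun φ v hv =>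
    (norm_nonneg _).trans (hΛ φ 0 v fun x => by simpa using hv x)
  let L : CompactlySupportedContinuousMap K ℝ →ₚ[ℝ] ℝ := PositiveLinearMap.mk₀
    { toFun := fun g => ∑ φ ∈ F, Λ φ (g : C(K, ℝ))
      map_add' := fun g g' => by
        rw [← Finset.sum_add_distrib]
        exact Finset.sum_congr rfl fun φ _ => (Λ φ).map_add _ _
      map_smul' := fun c g => by
        rw [RingHom.id_apply, Finset.smul_sum]
        exact Finset.sum_congr rfl fun φ _ => (Λ φ).map_smul c _ }
    fun g hg => Finset.sum_nonneg fun φ _ => hpos φ _ hg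
  refine ⟨RealRMK.rieszMeasure L, inferInstance, inferInstance, fun φ hφ h => ?_⟩
  let v : C(K, ℝ) := ⟨fun x => ‖h x‖, by fun_prop⟩
  have h1 := RealRMK.integral_rieszMeasure L (CompactlySupportedContinuousMap.continuousMapEquiv v)
  have h2 : L (CompactlySupportedContinuousMap.continuousMapEquiv v) = ∑ φ ∈ F, Λ φ v := rfl
  have h3 : ∫ x, (CompactlySupportedContinuousMap.continuousMapEquiv v) x
      ∂(RealRMK.rieszMeasure L) = ∫ x, ‖h x‖ ∂(RealRMK.rieszMeasure L) := rfl
  rw [← h3, h1, h2]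
  exact (hΛ φ h v fun x => le_rfl).trans
    (Finset.single_le_sum (f := fun φ => Λ φ v) (fun ψ _ => hpos ψ v fun x => norm_nonneg (h x)) hφ)

/-- A functional dominated by a measure is nearly given by a continuous density. -/
theorem exists_density_near {ν : Measure K} [IsFiniteMeasure ν] [ν.WeaklyRegular]
    {φ : StrongDual 𝕜 C(K, 𝕜)} (hφ : ∀ h : C(K, 𝕜), ‖φ h‖ ≤ ∫ x, ‖h x‖ ∂ν) {δ : ℝ} (hδ : 0 < δ) :
    ∃ d : C(K, 𝕜), ∀ g : C(K, 𝕜), ‖φ g - ∫ x, g x * d x ∂ν‖ ≤ δ * ‖g‖ := by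
  let J : C(K, 𝕜) →L[𝕜] Lp 𝕜 2 ν := ContinuousMap.toLp 2 ν 𝕜
  have hJ : DenseRange J := ContinuousMap.toLp_denseRange 𝕜 ν 𝕜 (by simp)
  have hinner : ∀ f g : C(K, 𝕜), inner 𝕜 (J f) (J g) = ∫ x, g x * (starRingEnd 𝕜) (f x) ∂ν :=
    ContinuousMap.inner_toLp ν
  have hbound : ∀ g, ‖φ g‖ ≤ ‖J 1‖ * ‖J g‖ := by
    intro g
    let a : C(K, 𝕜) := ⟨fun x => ((‖g x‖ : ℝ) : 𝕜), by fun_prop⟩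
    have h1 : inner 𝕜 (J 1) (J a) = ((∫ x, ‖g x‖ ∂ν : ℝ) : 𝕜) := by
      rw [hinner, ← integral_ofReal]
      simp [a]
    have h2 : ‖J a‖ = ‖J g‖ := by
      have : (‖J a‖ ^ 2 : 𝕜) = ‖J g‖ ^ 2 := by
        rw [← inner_self_eq_norm_sq_to_K, ← inner_self_eq_norm_sq_to_K, hinner, hinner]
        congr 1
        funext x
        rw [RCLike.mul_conj]
        simp only [a, ContinuousMap.coe_mk, RCLike.norm_ofReal, abs_norm]
        rw [RCLike.mul_conj]
      have h3 : ‖J a‖ ^ 2 = ‖J g‖ ^ 2 := by exact_mod_cast this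
      exact (sq_eq_sq₀ (norm_nonneg _) (norm_nonneg _)).1 h3
    have h3 := norm_inner_le_norm (𝕜 := 𝕜) (J 1) (J a)
    rw [h1, h2, RCLike.norm_ofReal] at h3
    exact (hφ g).trans ((le_abs_self _).trans h3)
  let Φ : StrongDual 𝕜 (Lp 𝕜 2 ν) := φ.toLinearMap.extendOfNorm J.toLinearMap
  have hΦ : ∀ g, Φ (J g) = φ g := LinearMap.extendOfNorm_eq hJ ⟨_, hbound⟩
  let ω : Lp 𝕜 2 ν := (InnerProductSpace.toDual 𝕜 _).symm Φ
  have hω : ∀ g, inner 𝕜 ω (J g) = φ g := fun g => by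
    rw [InnerProductSpace.toDual_symm_apply, hΦ]
  obtain ⟨d, hd⟩ := Metric.denseRange_iff.1 hJ ω (δ / (‖J‖ + 1)) (by positivity)
  refine ⟨star d, fun g => ?_⟩
  have h1 : φ g - ∫ x, g x * (star d) x ∂ν = inner 𝕜 (ω - J d) (J g) := by
    rw [inner_sub_left, hω, hinner]
    rfl
  rw [h1]
  rw [dist_eq_norm] at hd
  calc ‖inner 𝕜 (ω - J d) (J g)‖ ≤ ‖ω - J d‖ * ‖J g‖ := norm_inner_le_norm _ _
    _ ≤ δ / (‖J‖ + 1) * ((‖J‖ + 1) * ‖g‖) := by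
        gcongr
        refine (J.le_opNorm g).trans ?_
        gcongr
        linarith
    _ = δ * ‖g‖ := by field_simp

/-- Finitely many functionals on `C(K)` are almost fixed by a contraction of finite rank. -/
theorem exists_averaging {𝕜 : Type*} [RCLike 𝕜] {K : Type*} [TopologicalSpace K] [CompactSpace K]
    [T2Space K] (F : Finset (StrongDual 𝕜 C(K, 𝕜))) {ε : ℝ} (hε : 0 < ε) :
    ∃ R ∈ finiteRankMaps 𝕜 C(K, 𝕜) C(K, 𝕜), ‖R‖ ≤ 1 ∧ ∀ φ ∈ F, ‖φ ∘L R - φ‖ ≤ ε := by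
  classical
  borelize K
  obtain ⟨ν, _, _, hν⟩ := exists_measure_norm_le F
  set M : ℝ := ν.real Set.univ with hM
  have hM0 : 0 ≤ M := measureReal_nonneg
  set δ : ℝ := ε / (2 * (M + 1)) with hδ_def
  have hδ : 0 < δ := by positivity
  choose d hd using fun φ : F => exists_density_near (hν φ φ.2) hδ
  obtain ⟨s, h, hh0, hh1, hhd⟩ := exists_partition_near (F.attach.image d) hδ
  let I : StrongDual 𝕜 C(K, 𝕜) := LinearMap.mkContinuous
    { toFun := fun g => ∫ x, g x ∂ν
      map_add' := fun g g' => integral_add (integrable_of_continuous g.continuous)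
        (integrable_of_continuous g'.continuous)
      map_smul' := fun c g => integral_const_mul c _ } M fun g => by
    have := norm_integral_le_of_norm_le_const (μ := ν)
      (Filter.Eventually.of_forall fun x => g.norm_coe_le_norm x)
    rwa [mul_comm] at this
  have hI : ∀ g, I g = ∫ x, g x ∂ν := fun _ => rfl
  let η : s → C(K, 𝕜) := fun j => ⟨fun x => ((h j x : ℝ) : 𝕜), by fun_prop⟩
  have hη : ∀ j x, η j x = ((h j x : ℝ) : 𝕜) := fun _ _ => rfl
  have hηn : ∀ j x, ‖η j x‖ = h j x := fun j x => by
    rw [hη, RCLike.norm_ofReal, abs_of_nonneg (hh0 j x)]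
  have hη1 : ∑ j, η j = 1 := by
    ext x
    rw [ContinuousMap.sum_apply]
    simp only [hη, ContinuousMap.one_apply]
    rw [← RCLike.ofReal_sum, hh1, RCLike.ofReal_one]
  let m : s → ℝ := fun j => ∫ x, h j x ∂ν
  have hm0 : ∀ j, 0 ≤ m j := fun j => integral_nonneg (hh0 j)
  have hmI : ∀ j, I (η j) = (m j : 𝕜) := fun j => integral_ofReal
  have hm1 : ∑ j, m j = M := by
    simp only [m]
    rw [← integral_finsetSum _ fun j _ => integrable_of_continuous (h j).continuous]
    simp only [Finset.univ_eq_attach] at hh1 ⊢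
    simp [hh1, hM]
  have hB : ∀ j (k : C(K, 𝕜)) (c : ℝ), (∀ x, h j x ≠ 0 → ‖k x‖ ≤ c) →
      ‖I (η j * k)‖ ≤ m j * c := fun j k c hk => by
    rw [hI]
    refine (norm_integral_le_of_norm_le (g := fun x => h j x * c)
      (integrable_of_continuous (by fun_prop)) (Filter.Eventually.of_forall fun x => ?_)).trans_eq ?_
    · rw [ContinuousMap.mul_apply, norm_mul, hηn]
      rcases eq_or_ne (h j x) 0 with h0 | h0
      · simp [h0]
      · exact mul_le_mul_of_nonneg_left (hk x h0) (hh0 j x)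
    · exact integral_mul_const _ _
  have hB' : ∀ j (k : C(K, 𝕜)), ‖I (η j * k)‖ ≤ m j * ‖k‖ := fun j k =>
    hB j k _ fun x _ => k.norm_coe_le_norm x
  have hBm : ∀ j (k : C(K, 𝕜)), ‖(m j : 𝕜)⁻¹ * I (η j * k)‖ ≤ ‖k‖ := fun j k => by
    rw [norm_mul, norm_inv, RCLike.norm_ofReal, abs_of_nonneg (hm0 j)]
    rcases (hm0 j).eq_or_lt with h0 | h0
    · simp [← h0]
    · rw [inv_mul_le_iff₀ h0]
      exact hB' j k
  let R : C(K, 𝕜) →L[𝕜] C(K, 𝕜) := ∑ j,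
    ((m j : 𝕜)⁻¹ • (I ∘L ContinuousLinearMap.mul 𝕜 C(K, 𝕜) (η j))).smulRight (η j)
  have hR : ∀ g, R g = ∑ j, ((m j : 𝕜)⁻¹ * I (η j * g)) • η j := fun g => by
    simp [R, sum_apply]
  have hRn : ∀ g, ‖R g‖ ≤ ‖g‖ := fun g => by
    refine (ContinuousMap.norm_le _ (norm_nonneg _)).2 fun x => ?_
    rw [hR, ContinuousMap.sum_apply]
    calc ‖∑ j, (((m j : 𝕜)⁻¹ * I (η j * g)) • η j) x‖
        ≤ ∑ j, ‖(((m j : 𝕜)⁻¹ * I (η j * g)) • η j) x‖ := norm_sum_le _ _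
      _ ≤ ∑ j, ‖g‖ * h j x := by
          refine Finset.sum_le_sum fun j _ => ?_
          rw [ContinuousMap.smul_apply, norm_smul, hηn]
          exact mul_le_mul_of_nonneg_right (hBm j g) (hh0 j x)
      _ = ‖g‖ := by rw [← Finset.mul_sum, hh1, mul_one]
  refine ⟨R, Submodule.sum_mem _ fun j _ => smulRight_mem_finiteRankMaps _ _,
    ContinuousLinearMap.opNorm_le_bound _ zero_le_one fun g => by
      rw [one_mul]; exact hRn g, fun φ hφ => ?_⟩
  refine ContinuousLinearMap.opNorm_le_bound _ hε.le fun g => ?_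
  set D := d ⟨φ, hφ⟩
  have hDj : ∀ j x, h j x ≠ 0 → ‖(D - algebraMap 𝕜 C(K, 𝕜) (D j)) x‖ ≤ δ :=
    hhd D (Finset.mem_image_of_mem d (Finset.mem_attach F ⟨φ, hφ⟩))
  have e1 : I ((g - R g) * D) = ∑ j, (I (η j * (g * (D - algebraMap 𝕜 C(K, 𝕜) (D j)))) -
      (m j : 𝕜)⁻¹ * I (η j * g) * I (η j * (D - algebraMap 𝕜 C(K, 𝕜) (D j)))) := by
    have e2 : (g - R g) * D =
        ∑ j, (η j * (g * D) - ((m j : 𝕜)⁻¹ * I (η j * g)) • (η j * D)) := by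
      rw [Finset.sum_sub_distrib, ← Finset.sum_mul, hη1, one_mul, sub_mul, hR, Finset.sum_mul]
      simp only [smul_mul_assoc]
    rw [e2, map_sum]
    refine Finset.sum_congr rfl fun j _ => ?_
    have e3 : η j * (g * (D - algebraMap 𝕜 C(K, 𝕜) (D j))) =
        η j * (g * D) - (D j) • (η j * g) := by
      rw [Algebra.algebraMap_eq_smul_one, mul_sub, mul_sub, mul_smul_comm, mul_smul_comm, mul_one]
    have e4 : η j * (D - algebraMap 𝕜 C(K, 𝕜) (D j)) = η j * D - (D j) • η j := by
      rw [Algebra.algebraMap_eq_smul_one, mul_sub, mul_smul_comm, mul_one]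
    have e5 : (m j : 𝕜)⁻¹ * I (η j * g) * (m j : 𝕜) = I (η j * g) := by
      rcases eq_or_ne (m j) 0 with h0 | h0
      · have := hB' j g
        rw [h0, zero_mul, norm_le_zero_iff] at this
        rw [this, mul_zero, zero_mul]
      · have : (m j : 𝕜) ≠ 0 := RCLike.ofReal_ne_zero.2 h0
        field_simp
    rw [e3, e4, map_sub, map_sub, map_sub, map_smul, map_smul, map_smul, hmI]
    simp only [smul_eq_mul]
    linear_combination (-(D j)) * e5
  have h1 : ‖I ((g - R g) * D)‖ ≤ 2 * δ * M * ‖g‖ := by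
    rw [e1]
    calc _ ≤ ∑ j, ‖I (η j * (g * (D - algebraMap 𝕜 C(K, 𝕜) (D j)))) -
          (m j : 𝕜)⁻¹ * I (η j * g) * I (η j * (D - algebraMap 𝕜 C(K, 𝕜) (D j)))‖ :=
          norm_sum_le _ _
      _ ≤ ∑ j, m j * (2 * δ * ‖g‖) := by
          refine Finset.sum_le_sum fun j _ => (norm_sub_le _ _).trans ?_
          have b1 := hB j (g * (D - algebraMap 𝕜 C(K, 𝕜) (D j))) (‖g‖ * δ) fun x hx => by
            rw [ContinuousMap.mul_apply, norm_mul]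
            exact mul_le_mul (g.norm_coe_le_norm x) (hDj j x hx) (norm_nonneg _) (norm_nonneg _)
          have b2 := mul_le_mul (hBm j g) (hB j _ δ (hDj j)) (norm_nonneg _) (norm_nonneg _)
          rw [norm_mul ((m j : 𝕜)⁻¹ * I (η j * g))]
          linarith
      _ = 2 * δ * M * ‖g‖ := by rw [← Finset.sum_mul, hm1]; ring
  have h2 : ‖φ (g - R g) - I ((g - R g) * D)‖ ≤ δ * (2 * ‖g‖) := by
    refine (hd ⟨φ, hφ⟩ (g - R g)).trans (mul_le_mul_of_nonneg_left ?_ hδ.le)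
    have := norm_sub_le g (R g)
    have := hRn g
    linarith
  have h3 : (φ ∘L R - φ) g = -φ (g - R g) := by simp
  have h4 : δ * (2 * (M + 1)) = ε := by rw [hδ_def]; field_simp
  rw [h3, norm_neg]
  calc ‖φ (g - R g)‖ ≤ ‖φ (g - R g) - I ((g - R g) * D)‖ + ‖I ((g - R g) * D)‖ := by
        simpa using norm_add_le (φ (g - R g) - I ((g - R g) * D)) (I ((g - R g) * D))
    _ ≤ δ * (2 * ‖g‖) + 2 * δ * M * ‖g‖ := add_le_add h2 h1
    _ = ε * ‖g‖ := by rw [← h4]; ring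

/-- Approximable operators on `C(K)` with values in a closed subspace are approximable as
operators into that subspace. -/
theorem hasApproximableCorestriction_continuousMap (𝕜 : Type*) [RCLike 𝕜] (K : Type*)
    [TopologicalSpace K] [CompactSpace K] [T2Space K] :
    HasApproximableCorestriction.{w} 𝕜 C(K, 𝕜) := by
  classical
  choose R hR hR1 hRφ using fun i : Finset (StrongDual 𝕜 C(K, 𝕜)) × ℕ =>
    exists_averaging i.1 (ε := 1 / ((i.2 : ℝ) + 1)) (by positivity)
  refine hasApproximableCorestriction_of_tendsto (l := Filter.atTop) (R := R)
    (fun i => finiteRankMaps_le_approximableMaps (hR i)) zero_le_one hR1 fun φ => ?_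
  rw [Metric.tendsto_atTop]
  intro ε hε
  obtain ⟨n, hn⟩ := exists_nat_one_div_lt hε
  refine ⟨({φ}, n), fun i hi => ?_⟩
  rw [dist_eq_norm]
  refine (hRφ i φ (hi.1 (Finset.mem_singleton_self φ))).trans_lt (lt_of_le_of_lt ?_ hn)
  have : (n : ℝ) ≤ i.2 := by exact_mod_cast hi.2
  gcongr

end ContinuousFunctions

/-! ### Flatness of algebras of approximable operators -/

section Flat

theorem exists_linearMap_comp_eq {𝕜 U V W : Type*} [Field 𝕜] [AddCommGroup U] [Module 𝕜 U]
    [AddCommGroup V] [Module 𝕜 V] [AddCommGroup W] [Module 𝕜 W] (L : U →ₗ[𝕜] V) (L' : U →ₗ[𝕜] W)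
    (h : LinearMap.ker L ≤ LinearMap.ker L') : ∃ Φ : V →ₗ[𝕜] W, ∀ x, Φ (L x) = L' x := by
  obtain ⟨Φ, hΦ⟩ := LinearMap.exists_extend
    ((LinearMap.ker L).liftQ L' h ∘ₗ L.quotKerEquivRange.symm.toLinearMap)
  refine ⟨Φ, fun x => ?_⟩
  have h1 := LinearMap.congr_fun hΦ ⟨L x, x, rfl⟩
  refine h1.trans ?_
  have h2 : L.quotKerEquivRange.symm ⟨L x, x, rfl⟩ = (LinearMap.ker L).mkQ x := by
    rw [LinearEquiv.symm_apply_eq]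
    rfl
  rw [LinearMap.comp_apply, LinearEquiv.coe_coe, h2]
  rfl

variable {𝕜 : Type*} [RCLike 𝕜] {G : ℕ → Type*} [∀ i, NormedAddCommGroup (G i)]
  [∀ i, NormedSpace 𝕜 (G i)] {C : Type*} [NormedAddCommGroup C] [NormedSpace 𝕜 C]
  [CompleteSpace C]

theorem exists_mul_eq_of_coordinateSystem (hG : IsJohnsonSequence 𝕜 G)
    (s : CoordinateSystem 𝕜 G C) {X : Type*} [NormedAddCommGroup X] [NormedSpace 𝕜 X]
    [CompleteSpace X] (iC : C →L[𝕜] X) (pC : X →L[𝕜] C) (hC : ∀ x, pC (iC x) = x)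
    (a : approximableOperators 𝕜 X) : ∃ b c : approximableOperators 𝕜 X, a = b * c := by
  obtain ⟨v, hv, u, hu, huv⟩ := s.exists_factor hG a.2
  refine ⟨⟨u ∘L pC, approximableMaps_comp hu pC⟩, ⟨iC ∘L v, comp_mem_approximableMaps iC hv⟩,
    Subtype.ext (ContinuousLinearMap.ext fun x => ?_)⟩
  rw [← huv]
  change u (v x) = u (pC (iC (v x)))
  rw [hC]

/-- The algebra of approximable operators on `X` is left flat if `X` has approximable
corestrictions and a complemented copy of a sum of the spaces of a Johnson sequence. -/
theorem HasApproximableCorestriction.isLeftFlat (hG : IsJohnsonSequence 𝕜 G)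
    (s : CoordinateSystem 𝕜 G C) {X : Type w} [NormedAddCommGroup X] [NormedSpace 𝕜 X]
    [CompleteSpace X] (iC : C →L[𝕜] X) (pC : X →L[𝕜] C) (hC : ∀ x, pC (iC x) = x)
    (h : HasApproximableCorestriction.{w} 𝕜 X) : IsLeftFlat 𝕜 (approximableOperators 𝕜 X) := by
  classical
  refine isLeftFlat_of_factorization fun S hS => ?_
  have := hS.fintype
  let A := approximableOperators 𝕜 X
  let T : X →L[𝕜] (S → X) := ContinuousLinearMap.pi fun a => (a : A).1
  have hTa : ∀ x (a : S), T x a = (a : A).1 x := fun _ _ => rfl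
  have hT : T ∈ approximableMaps 𝕜 X (S → X) := by
    have : T = ∑ a : S, ContinuousLinearMap.single 𝕜 (fun _ : S => X) a ∘L (a : A).1 := by
      refine ContinuousLinearMap.ext fun x => funext fun b => ?_
      rw [sum_apply, Finset.sum_apply, Finset.sum_eq_single_of_mem b (Finset.mem_univ b)]
      · simp [hTa]
      · intro a _ hab
        simp [Pi.single_eq_of_ne hab.symm]
    rw [this]
    exact Submodule.sum_mem _ fun a _ => comp_mem_approximableMaps _ (a : A).2
  let Y := (LinearMap.range (T : X →ₗ[𝕜] (S → X))).topologicalClosure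
  have hYc : IsClosed (Y : Set (S → X)) := Submodule.isClosed_topologicalClosure _
  have hTY : ∀ x, T x ∈ Y := fun x => Submodule.le_topologicalClosure _ ⟨x, rfl⟩
  have hY : ∀ g : (S → X) →L[𝕜] X, (∀ x, g (T x) = 0) → ∀ y ∈ Y, g y = 0 := by
    intro g hg y hy
    refine (Submodule.topologicalClosure_minimal _ ?_ g.isClosed_ker :
      Y ≤ LinearMap.ker (g : (S → X) →ₗ[𝕜] X)) hy
    rintro _ ⟨x, rfl⟩
    exact hg x
  have : CompleteSpace Y := hYc.completeSpace_coe
  obtain ⟨v, hv, u, hu, huv⟩ := s.exists_factor hG (h (S → X) Y hYc T hT hTY)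
  let w : S → A := fun a => ⟨ContinuousLinearMap.proj (R := 𝕜) (φ := fun _ : S => X) a ∘L
    Y.subtypeL ∘L u ∘L pC, comp_mem_approximableMaps _ (comp_mem_approximableMaps _
      (approximableMaps_comp hu pC))⟩
  have hw : ∀ a x, (w a).1 x = (u (pC x) : S → X) a := fun _ _ => rfl
  obtain ⟨Φ, hΦ⟩ := exists_linearMap_comp_eq (Fintype.linearCombination 𝕜 fun a : S => (a : A))
    (Fintype.linearCombination 𝕜 w) fun c hc => by
      rw [LinearMap.mem_ker, Fintype.linearCombination_apply] at hc ⊢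
      refine Subtype.ext (ContinuousLinearMap.ext fun x => ?_)
      have h1 := hY (∑ a : S, c a • ContinuousLinearMap.proj (R := 𝕜) (φ := fun _ : S => X) a)
        (fun x => by
          have h2 := congrArg (fun b : A => b.1 x) hc
          simpa [sum_apply, hTa] using h2) _ (u (pC x)).2
      simpa [sum_apply, hw] using h1
  have hΦw : ∀ a : S, Φ (a : A) = w a := fun a => by
    have := hΦ (Pi.single a 1)
    rwa [Fintype.linearCombination_apply_single, Fintype.linearCombination_apply_single, one_smul,
      one_smul] at this
  refine ⟨⟨iC ∘L v, comp_mem_approximableMaps iC hv⟩, Φ, fun a ha => ⟨?_, fun c hca => ?_⟩⟩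
  · rw [hΦw ⟨a, ha⟩]
    refine Subtype.ext (ContinuousLinearMap.ext fun x => ?_)
    change (u (pC (iC (v x))) : S → X) ⟨a, ha⟩ = a.1 x
    rw [hC]
    have h1 : u (v x) = T.codRestrict Y hTY x := DFunLike.congr_fun huv x
    rw [h1]
    rfl
  · rw [hΦw ⟨a, ha⟩, hΦw ⟨c * a, hca⟩]
    refine Subtype.ext (ContinuousLinearMap.ext fun x => ?_)
    have h1 := hY (ContinuousLinearMap.proj (R := 𝕜) (φ := fun _ : S => X) ⟨c * a, hca⟩ -
      c.1 ∘L ContinuousLinearMap.proj (R := 𝕜) (φ := fun _ : S => X) ⟨a, ha⟩)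
      (fun x => sub_eq_zero.2 rfl) _ (u (pC x)).2
    exact sub_eq_zero.1 h1

end Flat

section SumWithCI

variable {𝕜 : Type u} [RCLike 𝕜] {E : Type v} [NormedAddCommGroup E] [NormedSpace 𝕜 E]
  {G : ℕ → Type*} [∀ i, NormedAddCommGroup (G i)] [∀ i, NormedSpace 𝕜 (G i)]
  {C : Type w} [NormedAddCommGroup C] [NormedSpace 𝕜 C]

theorem isLeftUniversallyFlat_iff_isLeftFlat_sumWithCI [CompleteSpace E] [CompleteSpace C]
    (hG : IsJohnsonSequence 𝕜 G) (s : CoordinateSystem 𝕜 G C) :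
    IsLeftUniversallyFlat 𝕜 (approximableOperators 𝕜 (SumWithCI 𝕜 E C)) ↔
      IsLeftFlat 𝕜 (approximableOperators 𝕜 (SumWithCI 𝕜 E C)) :=
  ⟨fun h => h.isLeftFlat, fun h => h.isLeftUniversallyFlat
    (exists_mul_eq_of_coordinateSystem hG s
      (ContinuousLinearMap.inr 𝕜 E (C × C(unitInterval, 𝕜)) ∘L
        ContinuousLinearMap.inl 𝕜 C C(unitInterval, 𝕜))
      (ContinuousLinearMap.fst 𝕜 C C(unitInterval, 𝕜) ∘L
        ContinuousLinearMap.snd 𝕜 E (C × C(unitInterval, 𝕜))) fun _ => rfl)⟩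

theorem hasApproximationProperty_dual_of_isLeftFlat_sumWithCI
    (h : IsLeftFlat 𝕜 (approximableOperators 𝕜 (SumWithCI 𝕜 E C))) :
    HasApproximationProperty 𝕜 (StrongDual 𝕜 E) := by
  have : Infinite unitInterval := (Set.Icc_infinite zero_lt_one).to_subtype
  exact hasApproximationProperty_dual_of_isLeftFlat (K := unitInterval)
    (ContinuousLinearMap.inl 𝕜 E (C × C(unitInterval, 𝕜)))
    (ContinuousLinearMap.fst 𝕜 E (C × C(unitInterval, 𝕜))) (fun _ => rfl)
    (ContinuousLinearMap.inr 𝕜 E (C × C(unitInterval, 𝕜)) ∘L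
      ContinuousLinearMap.inr 𝕜 C C(unitInterval, 𝕜))
    (ContinuousLinearMap.snd 𝕜 C C(unitInterval, 𝕜) ∘L
      ContinuousLinearMap.snd 𝕜 E (C × C(unitInterval, 𝕜))) (fun _ => rfl) h

theorem isLeftFlat_sumWithCI [CompleteSpace E] [CompleteSpace C] (hG : IsJohnsonSequence 𝕜 G)
    (s : CoordinateSystem 𝕜 G C) (hC : HasApproximableCorestriction.{max u v w} 𝕜 C)
    (hE : HasApproximationProperty 𝕜 (StrongDual 𝕜 E)) :
    IsLeftFlat 𝕜 (approximableOperators 𝕜 (SumWithCI 𝕜 E C)) :=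
  HasApproximableCorestriction.isLeftFlat hG s
    (ContinuousLinearMap.inr 𝕜 E (C × C(unitInterval, 𝕜)) ∘L
      ContinuousLinearMap.inl 𝕜 C C(unitInterval, 𝕜))
    (ContinuousLinearMap.fst 𝕜 C C(unitInterval, 𝕜) ∘L
      ContinuousLinearMap.snd 𝕜 E (C × C(unitInterval, 𝕜))) (fun _ => rfl)
    (hE.hasApproximableCorestriction.prod
      (hC.prod (hasApproximableCorestriction_continuousMap 𝕜 unitInterval)))

theorem tfae_sumWithCI [CompleteSpace E] [CompleteSpace C] (hG : IsJohnsonSequence 𝕜 G)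
    (s : CoordinateSystem 𝕜 G C) (hC : HasApproximableCorestriction.{max u v w} 𝕜 C) :
    List.TFAE [
      HasApproximationProperty 𝕜 (StrongDual 𝕜 E),
      IsLeftFlat 𝕜 (approximableOperators 𝕜 (SumWithCI 𝕜 E C)),
      IsLeftUniversallyFlat 𝕜 (approximableOperators 𝕜 (SumWithCI 𝕜 E C))] := by
  tfae_have 1 → 2 := isLeftFlat_sumWithCI hG s hC
  tfae_have 2 → 1 := hasApproximationProperty_dual_of_isLeftFlat_sumWithCI
  tfae_have 2 ↔ 3 := (isLeftUniversallyFlat_iff_isLeftFlat_sumWithCI hG s).symm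
  tfae_finish

end SumWithCI

theorem theorem2 {𝕜 : Type*} [RCLike 𝕜]
    {E : Type*} [NormedAddCommGroup E] [NormedSpace 𝕜 E] [CompleteSpace E]
    (G : ℕ → Type*) [∀ i, NormedAddCommGroup (G i)] [∀ i, NormedSpace 𝕜 (G i)]
    (hG : IsJohnsonSequence 𝕜 G) :
    (∀ (p : ℝ≥0∞) [Fact (1 ≤ p)], 1 < p → p < ∞ →
      List.TFAE [
        HasApproximationProperty 𝕜 (StrongDual 𝕜 E),
        IsLeftFlat 𝕜 (approximableOperators 𝕜 (SumWithCI 𝕜 E (lp G p))),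
        IsLeftUniversallyFlat 𝕜 (approximableOperators 𝕜 (SumWithCI 𝕜 E (lp G p)))]) ∧
    List.TFAE [
      HasApproximationProperty 𝕜 (StrongDual 𝕜 E),
      IsLeftFlat 𝕜 (approximableOperators 𝕜 (SumWithCI 𝕜 E (c0Sum 𝕜 G))),
      IsLeftUniversallyFlat 𝕜 (approximableOperators 𝕜 (SumWithCI 𝕜 E (c0Sum 𝕜 G)))] ∧
    (∀ (p : ℝ≥0∞) [Fact (1 ≤ p)],
      (IsLeftUniversallyFlat 𝕜 (approximableOperators 𝕜 (SumWithCI 𝕜 E (lp G p))) ↔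
        IsLeftFlat 𝕜 (approximableOperators 𝕜 (SumWithCI 𝕜 E (lp G p)))) ∧
      (IsLeftFlat 𝕜 (approximableOperators 𝕜 (SumWithCI 𝕜 E (lp G p))) →
        HasApproximationProperty 𝕜 (StrongDual 𝕜 E))) := by
  have := hG.finiteDimensional
  refine ⟨fun p _ hp hp' => ?_, ?_, fun p _ => ?_⟩
  · have := completeSpace_lp hG p
    exact tfae_sumWithCI hG (lpCoordinates p) (hasApproximableCorestriction_lp p hp hp')
  · have := completeSpace_c0Sum hG
    exact tfae_sumWithCI hG c0Coordinates hasApproximableCorestriction_c0Sum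
  · have := completeSpace_lp hG p
    exact ⟨isLeftUniversallyFlat_iff_isLeftFlat_sumWithCI hG (lpCoordinates p),
      hasApproximationProperty_dual_of_isLeftFlat_sumWithCI⟩
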